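/- Let $n\ge 2$ be an integer, $d\ge 1$ and $\alpha\in\mathbb R$, $\alpha\neq 0$, and assume that $n$ is odd if $\alpha>0$. Let $D\in\mathbb R^{n\times n}$ be the Jordan block with $d$ on the diagonal and $1$ on the superdiagonal, and let $A\in\mathbb R^{n\times n}$ be the matrix whose only nonzero entry is $\alpha$, in the last row and first column. Let $L^\star=-D^\star\partial_{xx}+A^\star$ be the operator on $L^2(0,\pi;\mathbb C^n)$ with domain $H^2(0,\pi;\mathbb C^n)\cap H^1_0(0,\pi;\mathbb C^n)$, and let $\mu(\lambda)=\dim\ker(L^\star-\lambda)$ be the geometric multiplicity of $\lambda$. For $k\ge 1$ and $0\le j\le n-1$ put $$\lambda_{j,k}=dk^2+|\alpha|^{1/n}k^{2-\frac2n}e^{\frac{2\pi j}{n}i}\ \text{ if }\alpha>0,\qquad \lambda_{j,k}=dk^2+|\alpha|^{1/n}k^{2-\frac2n}e^{\frac{(2j+1)\pi}{n}i}\ \text{ if }\alpha<0,$$ and let $$\mathcal J=\{(j,k):\ 0\le j\le n-1,\ k\ge 1,\ \mu(\lambda_{j,k})=1,\ \Re(\lambda_{j,k})>0\}.$$ Then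 $\mathcal J$ is infinite and the sequence $\Lambda=\{\lambda_{j,k}\}_{(j,k)\in\mathcal J}$ satisfies: its terms are pairwise distinct, $\sum_{(j,k)\in\mathcal J}1/|\lambda_{j,k}|<\infty$, and there is $\delta>0$ such that $\Re(\lambda_{j,k})\ge\delta|\lambda_{j,k}|>0$ for all $(j,k)\in\mathcal J$. Moreover, its condensation index is zero, $c(\Lambda)=0$, where, for a sequence $\Lambda=\{\Lambda_k\}$ with these three properties, $$c(\Lambda)=\limsup_{k\to\infty}\frac{-\ln|E'(\Lambda_k)|}{\Re(\Lambda_k)},\qquad E(z)=\prod_{k}\Bigl(1-\frac{z^2}{\Lambda_k^2}\Bigr).$$ -/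

import Mathlib

noncomputable section

namespace ParabolicJordan

/-- Lebesgue measure on the interval `(0, π)`. -/
abbrev intervalMeasure : MeasureTheory.Measure ℝ :=
  MeasureTheory.volume.restrict (Set.Ioo (0 : ℝ) Real.pi)

/-- The complex space `L²(0, π)`. -/
abbrev L2 : Type := MeasureTheory.Lp ℂ 2 intervalMeasure

/-- The space `L²(0, π; ℂⁿ)`, given by components (only its vector space structure is used). -/
abbrev L2Vec (n : ℕ) : Type := Fin n → L2

/-- Complex-valued test functions: smooth, with compact support inside `(0, π)`. -/
structure IsTest (φ : ℝ → ℂ) : Prop where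
  smooth : ContDiff ℝ (⊤ : ℕ∞) φ
  compact : HasCompactSupport φ
  supp : tsupport φ ⊆ Set.Ioo (0 : ℝ) Real.pi

theorem integrable_mul_L2 {φ : ℝ → ℂ} (hc : Continuous φ) (hs : HasCompactSupport φ)
    (u : L2) : MeasureTheory.Integrable (fun x => φ x * u x) intervalMeasure := by
  have h1 : MeasureTheory.MemLp φ 2 intervalMeasure :=
    (hc.memLp_of_hasCompactSupport hs)
  exact h1.integrable_mul (MeasureTheory.Lp.memLp u)

theorem IsTest.zero : IsTest (fun _ => (0 : ℂ)) where
  smooth := contDiff_const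
  compact := HasCompactSupport.zero
  supp := by
    have h : tsupport (fun _ : ℝ => (0 : ℂ)) = ∅ := by
      rw [tsupport_eq_empty_iff]; rfl
    rw [h]; exact Set.empty_subset _

theorem IsTest.add {φ ψ : ℝ → ℂ} (hφ : IsTest φ) (hψ : IsTest ψ) :
    IsTest (fun x => φ x + ψ x) where
  smooth := hφ.smooth.add hψ.smooth
  compact := hφ.compact.add hψ.compact
  supp := (tsupport_add φ ψ).trans (Set.union_subset hφ.supp hψ.supp)

theorem IsTest.smul {φ : ℝ → ℂ} (hφ : IsTest φ) (c : ℂ) : IsTest (fun x => c * φ x) where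
  smooth := contDiff_const.mul hφ.smooth
  compact := hφ.compact.mul_left
  supp := (tsupport_mul_subset_right (f := fun _ : ℝ => c) (g := φ)).trans hφ.supp

/-- `v` is the weak derivative of `u` on `(0, π)`. -/
def IsWeakDeriv (u v : L2) : Prop :=
  ∀ φ : ℝ → ℂ, IsTest φ →
    ∫ x, deriv φ x * u x ∂intervalMeasure = -∫ x, φ x * v x ∂intervalMeasure

/-- `u ∈ H¹₀(0, π)` with weak derivative `v`: the pair `(u, v)` is the limit, in `L² × L²`, of
pairs `(φ, φ')` with `φ` a test function; that is, `u` lies in the closure of the test functions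
in `H¹(0, π)`. -/
def IsH10Deriv (u v : L2) : Prop :=
  IsWeakDeriv u v ∧
  ∀ ε : ENNReal, ε ≠ 0 → ∃ φ : ℝ → ℂ, IsTest φ ∧
    MeasureTheory.eLpNorm (fun x => u x - φ x) 2 intervalMeasure ≤ ε ∧
    MeasureTheory.eLpNorm (fun x => v x - deriv φ x) 2 intervalMeasure ≤ ε

theorem IsWeakDeriv.zero : IsWeakDeriv 0 0 := by
  intro φ _
  have h := MeasureTheory.Lp.coeFn_zero ℂ 2 intervalMeasure
  have h1 : ∫ x, deriv φ x * (0 : L2) x ∂intervalMeasure = 0 :=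
    MeasureTheory.integral_eq_zero_of_ae (by filter_upwards [h] with x hx; rw [hx]; simp)
  have h2 : ∫ x, φ x * (0 : L2) x ∂intervalMeasure = 0 :=
    MeasureTheory.integral_eq_zero_of_ae (by filter_upwards [h] with x hx; rw [hx]; simp)
  rw [h1, h2, neg_zero]

theorem IsWeakDeriv.add {u v u' v' : L2} (h : IsWeakDeriv u v) (h' : IsWeakDeriv u' v') :
    IsWeakDeriv (u + u') (v + v') := by
  intro φ hφ
  have key : ∀ (ψ : ℝ → ℂ), Continuous ψ → HasCompactSupport ψ → ∀ a b : L2,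
      ∫ x, ψ x * (a + b : L2) x ∂intervalMeasure
        = ∫ x, ψ x * a x ∂intervalMeasure + ∫ x, ψ x * b x ∂intervalMeasure := by
    intro ψ hc hs a b
    rw [← MeasureTheory.integral_add (integrable_mul_L2 hc hs a)
      (integrable_mul_L2 hc hs b)]
    refine MeasureTheory.integral_congr_ae ?_
    filter_upwards [MeasureTheory.Lp.coeFn_add a b] with x hx
    rw [hx, Pi.add_apply, mul_add]
  rw [key _ (hφ.smooth.continuous_deriv (by simp)) hφ.compact.deriv,
    key _ hφ.smooth.continuous hφ.compact, h φ hφ, h' φ hφ, neg_add]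

theorem IsWeakDeriv.smul {u v : L2} (h : IsWeakDeriv u v) (c : ℂ) :
    IsWeakDeriv (c • u) (c • v) := by
  intro φ hφ
  have key : ∀ (ψ : ℝ → ℂ) (a : L2),
      ∫ x, ψ x * (c • a : L2) x ∂intervalMeasure = c * ∫ x, ψ x * a x ∂intervalMeasure := by
    intro ψ a
    rw [← MeasureTheory.integral_const_mul]
    refine MeasureTheory.integral_congr_ae ?_
    filter_upwards [MeasureTheory.Lp.coeFn_smul c a] with x hx
    simp only [hx, Pi.smul_apply, smul_eq_mul]
    ring
  rw [key, key, h φ hφ, mul_neg]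

theorem IsH10Deriv.zero : IsH10Deriv 0 0 := by
  refine ⟨IsWeakDeriv.zero, fun ε _ => ⟨_, IsTest.zero, ?_⟩⟩
  have h := MeasureTheory.Lp.coeFn_zero ℂ 2 intervalMeasure
  have h0 : MeasureTheory.eLpNorm (fun x => (0 : L2) x) 2 intervalMeasure = 0 := by
    rw [MeasureTheory.eLpNorm_congr_ae h]; simp
  simp only [sub_zero, deriv_const, h0, zero_le, and_self]

theorem IsH10Deriv.add {u v u' v' : L2} (h : IsH10Deriv u v) (h' : IsH10Deriv u' v') :
    IsH10Deriv (u + u') (v + v') := by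
  refine ⟨h.1.add h'.1, fun ε hε => ?_⟩
  obtain ⟨φ, hφ, h1, h2⟩ := h.2 (ε / 2) (by simpa using hε)
  obtain ⟨ψ, hψ, h3, h4⟩ := h'.2 (ε / 2) (by simpa using hε)
  refine ⟨_, hφ.add hψ, ?_, ?_⟩
  · have e : (fun x => (u + u' : L2) x - (φ x + ψ x)) =ᵐ[intervalMeasure]
        (fun x => u x - φ x) + (fun x => u' x - ψ x) := by
      filter_upwards [MeasureTheory.Lp.coeFn_add u u'] with x hx
      simp only [hx, Pi.add_apply]
      ring
    rw [MeasureTheory.eLpNorm_congr_ae e]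
    refine (MeasureTheory.eLpNorm_add_le ?_ ?_ (by norm_num)).trans
      ((add_le_add h1 h3).trans (ENNReal.add_halves ε).le)
    · exact (MeasureTheory.Lp.aestronglyMeasurable u).sub
        hφ.smooth.continuous.aestronglyMeasurable
    · exact (MeasureTheory.Lp.aestronglyMeasurable u').sub
        hψ.smooth.continuous.aestronglyMeasurable
  · have e : (fun x => (v + v' : L2) x - deriv (fun y => φ y + ψ y) x) =ᵐ[intervalMeasure]
        (fun x => v x - deriv φ x) + (fun x => v' x - deriv ψ x) := by
      filter_upwards [MeasureTheory.Lp.coeFn_add v v'] with x hx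
      have hd : deriv (fun y => φ y + ψ y) x = deriv φ x + deriv ψ x :=
        deriv_fun_add (hφ.smooth.differentiable (by simp) x)
          (hψ.smooth.differentiable (by simp) x)
      simp only [hx, Pi.add_apply, hd]
      ring
    rw [MeasureTheory.eLpNorm_congr_ae e]
    refine (MeasureTheory.eLpNorm_add_le ?_ ?_ (by norm_num)).trans
      ((add_le_add h2 h4).trans (ENNReal.add_halves ε).le)
    · exact (MeasureTheory.Lp.aestronglyMeasurable v).sub
        (hφ.smooth.continuous_deriv (by simp)).aestronglyMeasurable
    · exact (MeasureTheory.Lp.aestronglyMeasurable v').sub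
        (hψ.smooth.continuous_deriv (by simp)).aestronglyMeasurable

theorem IsH10Deriv.smul {u v : L2} (h : IsH10Deriv u v) (c : ℂ) :
    IsH10Deriv (c • u) (c • v) := by
  refine ⟨h.1.smul c, fun ε hε => ?_⟩
  obtain ⟨φ, hφ, h1, h2⟩ := h.2 (ε / ‖c‖ₑ) (by simp [hε])
  refine ⟨_, hφ.smul c, ?_, ?_⟩
  · have e : (fun x => (c • u : L2) x - c * φ x) =ᵐ[intervalMeasure]
        c • (fun x => u x - φ x) := by
      filter_upwards [MeasureTheory.Lp.coeFn_smul c u] with x hx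
      simp only [hx, Pi.smul_apply, smul_eq_mul]
      ring
    rw [MeasureTheory.eLpNorm_congr_ae e, MeasureTheory.eLpNorm_const_smul]
    exact (mul_le_mul_right h1 _).trans ENNReal.mul_div_le
  · have e : (fun x => (c • v : L2) x - deriv (fun y => c * φ y) x) =ᵐ[intervalMeasure]
        c • (fun x => v x - deriv φ x) := by
      filter_upwards [MeasureTheory.Lp.coeFn_smul c v] with x hx
      simp only [hx, Pi.smul_apply, smul_eq_mul, deriv_const_mul_field]
      ring
    rw [MeasureTheory.eLpNorm_congr_ae e, MeasureTheory.eLpNorm_const_smul]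
    exact (mul_le_mul_right h2 _).trans ENNReal.mul_div_le

/-- The graph of `∂ₓₓ` with domain `H²(0, π) ∩ H¹₀(0, π)`: the pairs `(u, u'')`. -/
def dirichletLaplacianGraph : Submodule ℂ (L2 × L2) where
  carrier := {p | ∃ v : L2, IsH10Deriv p.1 v ∧ IsWeakDeriv v p.2}
  zero_mem' := ⟨0, IsH10Deriv.zero, IsWeakDeriv.zero⟩
  add_mem' := by
    rintro p q ⟨v, h1, h2⟩ ⟨v', h1', h2'⟩
    exact ⟨v + v', h1.add h1', h2.add h2'⟩
  smul_mem' := by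
    rintro c p ⟨v, h1, h2⟩
    exact ⟨c • v, h1.smul c, h2.smul c⟩

/-- The Jordan block `D`, with `d` on the diagonal and `1` on the superdiagonal. -/
def matD (n : ℕ) (d : ℝ) : Matrix (Fin n) (Fin n) ℝ :=
  Matrix.of fun i j => if i = j then d else if (i : ℕ) + 1 = j then 1 else 0

/-- The matrix `A`, whose only possibly nonzero entry is `α`, in the last row and first column. -/
def matA (n : ℕ) (α : ℝ) : Matrix (Fin n) (Fin n) ℝ :=
  Matrix.of fun i j => if (i : ℕ) + 1 = n ∧ (j : ℕ) = 0 then α else 0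

/-- The graph of `L⋆ = -D⋆ ∂ₓₓ + A⋆`, with domain `H²(0, π; ℂⁿ) ∩ H¹₀(0, π; ℂⁿ)`. -/
def adjointGraph (n : ℕ) (d α : ℝ) : Submodule ℂ (L2Vec n × L2Vec n) where
  carrier := {p | ∃ w : L2Vec n, (∀ i, (p.1 i, w i) ∈ dirichletLaplacianGraph) ∧
    ∀ i, p.2 i = -(∑ j, (((matD n d).transpose i j : ℝ) : ℂ) • w j)
      + ∑ j, (((matA n α).transpose i j : ℝ) : ℂ) • p.1 j}
  zero_mem' := ⟨0, fun _ => dirichletLaplacianGraph.zero_mem, fun _ => by simp⟩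
  add_mem' := by
    rintro p q ⟨w, h1, h2⟩ ⟨w', h1', h2'⟩
    refine ⟨w + w', fun i => dirichletLaplacianGraph.add_mem (h1 i) (h1' i), fun i => ?_⟩
    simp only [Prod.snd_add, Prod.fst_add, Pi.add_apply, h2 i, h2' i, smul_add,
      Finset.sum_add_distrib]
    abel
  smul_mem' := by
    rintro c p ⟨w, h1, h2⟩
    refine ⟨c • w, fun i => dirichletLaplacianGraph.smul_mem c (h1 i), fun i => ?_⟩
    simp only [Prod.smul_snd, Prod.smul_fst, Pi.smul_apply, h2 i, smul_add, smul_neg,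
      Finset.smul_sum]
    simp only [smul_comm c]

/-- The kernel of `L⋆ - z`: all `f` in the domain of `L⋆` with `L⋆ f = z f`. -/
def eigenspace (n : ℕ) (d α : ℝ) (z : ℂ) : Submodule ℂ (L2Vec n) :=
  (adjointGraph n d α).comap (LinearMap.prod LinearMap.id (z • LinearMap.id))

/-- The geometric multiplicity `μ(z)` of `z` as an eigenvalue of `L⋆`. -/
def geomMult (n : ℕ) (d α : ℝ) (z : ℂ) : ℕ :=
  Module.finrank ℂ (eigenspace n d α z)

/-- The number `λ_{j,k}`, for `α ≠ 0`. -/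
def eigval (n : ℕ) (d α : ℝ) (j k : ℕ) : ℂ :=
  ((d * (k : ℝ) ^ 2 : ℝ) : ℂ)
    + ((|α| ^ (1 / (n : ℝ)) * (k : ℝ) ^ (2 - 2 / (n : ℝ)) : ℝ) : ℂ) *
      (if 0 < α then Complex.exp (2 * Real.pi * j / n * Complex.I)
        else Complex.exp ((2 * j + 1) * Real.pi / n * Complex.I))

/-- The index set `𝒥` of the simple eigenvalues of `L⋆` with positive real part. -/
def indexSet (n : ℕ) (d α : ℝ) : Set (Fin n × ℕ) :=
  {p | 1 ≤ p.2 ∧ geomMult n d α (eigval n d α p.1 p.2) = 1 ∧ 0 < (eigval n d α p.1 p.2).re}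

/-- The family `{λ_{j,k}}` indexed by `𝒥`. -/
def simpleEigval (n : ℕ) (d α : ℝ) : indexSet n d α → ℂ :=
  fun p => eigval n d α p.1.1 p.1.2

/-- The hypothesis on a complex sequence: distinct terms, summable reciprocals, and values in a
sector strictly inside the right half plane. The index type is arbitrary because nothing here
depends on the order of the terms. -/
def SectorialSummable {ι : Type*} (Λ : ι → ℂ) : Prop :=
  (∀ i k, i ≠ k → Λ i ≠ Λ k) ∧ Summable (fun k => 1 / ‖Λ k‖) ∧
    ∃ δ : ℝ, 0 < δ ∧ ∀ k, δ * ‖Λ k‖ ≤ (Λ k).re ∧ 0 < δ * ‖Λ k‖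

/-- The interpolating function `E(z) = ∏ₖ (1 - z² / Λₖ²)`. -/
def interpolating {ι : Type*} (Λ : ι → ℂ) (z : ℂ) : ℂ :=
  ∏' k, (1 - z ^ 2 / Λ k ^ 2)

/-- The condensation index `c(Λ) = limsupₖ (-ln |E'(Λₖ)| / Re Λₖ)`, for `Λ` with distinct terms,
summable reciprocals, and values in a sector strictly inside the right half plane (then the product
`E` is entire and `E'(Λₖ) ≠ 0`). The limit superior is along the complements of finite sets of
indices; for sequences indexed by `ℕ` this is the usual one. -/
def condensationIndex {ι : Type*} (Λ : ι → ℂ) : EReal :=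
  Filter.limsup
    (fun k => ((-Real.log ‖deriv (interpolating Λ) (Λ k)‖ / (Λ k).re : ℝ) : EReal))
    Filter.cofinite

end ParabolicJordan

end

noncomputable section

namespace ParabolicJordan

/-! ### The Dirichlet Laplacian in sine coefficients, and completeness of the sines. -/

section DirichletSines

open Filter Topology MeasureTheory

/-! Sine coefficients decouple `L⋆` into the matrices `k² D⋆ + A⋆`. In mode `k` the last component
of an eigenvector determines the others, so each matrix eigenspace is at most a line, and the
characteristic equation is `(z - d k²)ⁿ = α k^(2(n-1))`, with roots `λ_{j,k}` (`char_eq_iff`). Since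
the sines are complete (`eq_zero_of_sinCoef_eq_zero`), an eigenvalue is geometrically simple exactly
when it occurs in a single mode (`geomMult_eq_one`, `geomMult_ne_one`). This gives the distinctness
of the terms of `Λ`.

The dominant term `d k²` gives the sector and makes `∑ |λ|^(-p)` converge for `p > 1/2`. The
correction `k^(2-2/n)` is of lower order, but it must be controlled when comparing different
branches. `exists_eigval_gap` shows that eigenvalues stay a fixed distance apart once the larger
mode is large: differences of real parts gain a factor `k^(2/n)` over differences of `k^(2-2/n)`,
and imaginary parts handle the remaining cases. Two real roots `±1` would leave only real parts to
compare, with possible near coincidences; the parity assumption excludes this. The gap also shows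
that all but finitely many eigenvalues are simple, whence `𝒥` is infinite.

For the condensation index, `E'(Λₖ)` is `-2/Λₖ` times the product of `1 - Λₖ²/Λₘ²` over `m ≠ k`.
With the gap and the sector, the logarithm of each factor is `O((1 + log |Λₖ|) (|Λₖ|/|Λₘ|)^(3/4))`
(`abs_log_norm_factor_le`). Summing over `m` yields `log |E'(Λₖ)| = O(|Λₖ|^(7/8))`, which is
negligible against `Re Λₖ`. Thus the quotient has limit zero, not merely limsup zero. -/

theorem memLp_of_continuous {f : ℝ → ℂ} (hf : Continuous f) : MemLp f 2 intervalMeasure := by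
  obtain ⟨C, hC⟩ := isCompact_Icc.exists_bound_of_continuousOn (s := Set.Icc 0 Real.pi)
    hf.continuousOn
  refine MemLp.of_bound hf.aestronglyMeasurable C ?_
  filter_upwards [ae_restrict_mem measurableSet_Ioo] with x hx
  exact hC x ⟨hx.1.le, hx.2.le⟩

theorem integrable_continuous_mul {f : ℝ → ℂ} (hf : Continuous f) (u : L2) :
    Integrable (fun x => f x * u x) intervalMeasure :=
  (memLp_of_continuous hf).integrable_mul (Lp.memLp u)

/-- The class in `L²(0, π)` of a continuous function. -/
def ofContinuous (f : ℝ → ℂ) (hf : Continuous f) : L2 := (memLp_of_continuous hf).toLp f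

theorem coeFn_ofContinuous {f : ℝ → ℂ} (hf : Continuous f) :
    ofContinuous f hf =ᵐ[intervalMeasure] f := (memLp_of_continuous hf).coeFn_toLp

theorem integral_mul_ofContinuous (φ : ℝ → ℂ) {f : ℝ → ℂ} (hf : Continuous f) :
    ∫ x, φ x * ofContinuous f hf x ∂intervalMeasure = ∫ x, φ x * f x ∂intervalMeasure := by
  refine integral_congr_ae ?_
  filter_upwards [coeFn_ofContinuous hf] with x hx
  rw [hx]

/-- The linear functional `u ↦ ∫ f u` for continuous `f`. -/
def pairing (f : ℝ → ℂ) (hf : Continuous f) : L2 →ₗ[ℂ] ℂ where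
  toFun u := ∫ x, f x * u x ∂intervalMeasure
  map_add' u v := by
    rw [← integral_add (integrable_continuous_mul hf u) (integrable_continuous_mul hf v)]
    refine integral_congr_ae ?_
    filter_upwards [Lp.coeFn_add u v] with x hx
    rw [hx, Pi.add_apply, mul_add]
  map_smul' c u := by
    rw [RingHom.id_apply, smul_eq_mul, ← integral_const_mul]
    refine integral_congr_ae ?_
    filter_upwards [Lp.coeFn_smul c u] with x hx
    rw [hx, Pi.smul_apply, smul_eq_mul]
    ring

theorem IsTest.eq_zero_of_notMem {φ : ℝ → ℂ} (hφ : IsTest φ) {x : ℝ}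
    (hx : x ∉ Set.Ioo (0 : ℝ) Real.pi) : φ x = 0 :=
  image_eq_zero_of_notMem_tsupport fun h => hx (hφ.supp h)

theorem IsTest.hasDerivAt {φ : ℝ → ℂ} (hφ : IsTest φ) (x : ℝ) : HasDerivAt φ (deriv φ x) x :=
  (hφ.smooth.differentiable (by simp) x).hasDerivAt

theorem IsTest.continuous_deriv {φ : ℝ → ℂ} (hφ : IsTest φ) : Continuous (deriv φ) :=
  hφ.smooth.continuous_deriv (by simp)

/-- Integration by parts against a test function. -/
theorem IsTest.integral_deriv_mul {φ g g' : ℝ → ℂ} (hφ : IsTest φ)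
    (hg : ∀ x, HasDerivAt g (g' x) x) (hg' : Continuous g') :
    ∫ x, deriv φ x * g x ∂intervalMeasure = -∫ x, φ x * g' x ∂intervalMeasure := by
  have hgc : Continuous g := continuous_iff_continuousAt.2 fun x => (hg x).continuousAt
  have hz : ∀ f : ℝ → ℂ, ∫ x, f x ∂intervalMeasure = ∫ x in (0 : ℝ)..Real.pi, f x := fun f => by
    rw [intervalIntegral.integral_of_le Real.pi_pos.le, integral_Ioc_eq_integral_Ioo]
  have h := intervalIntegral.integral_deriv_mul_eq_sub (u := φ) (v := g) (a := 0) (b := Real.pi)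
    (fun x _ => hφ.hasDerivAt x) (fun x _ => hg x)
    (hφ.continuous_deriv.intervalIntegrable _ _) (hg'.intervalIntegrable _ _)
  have hadd : ∫ x in (0 : ℝ)..Real.pi, deriv φ x * g x + φ x * g' x
      = (∫ x in (0 : ℝ)..Real.pi, deriv φ x * g x) + ∫ x in (0 : ℝ)..Real.pi, φ x * g' x :=
    intervalIntegral.integral_add ((hφ.continuous_deriv.mul hgc).intervalIntegrable _ _)
      ((hφ.smooth.continuous.mul hg').intervalIntegrable _ _)
  rw [hadd, hφ.eq_zero_of_notMem (fun h => h.1.ne rfl), hφ.eq_zero_of_notMem (fun h => h.2.ne rfl)] at h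
  rw [hz, hz]
  linear_combination h

theorem IsWeakDeriv.of_hasDerivAt {g g' : ℝ → ℂ} (hg : ∀ x, HasDerivAt g (g' x) x)
    (hgc : Continuous g) (hg' : Continuous g') :
    IsWeakDeriv (ofContinuous g hgc) (ofContinuous g' hg') := fun φ hφ => by
  rw [integral_mul_ofContinuous, integral_mul_ofContinuous, hφ.integral_deriv_mul hg hg']

theorem enorm_integral_mul_le {f g : ℝ → ℂ} (hf : MemLp f 2 intervalMeasure)
    (hg : MemLp g 2 intervalMeasure) :
    ‖∫ x, f x * g x ∂intervalMeasure‖ₑ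
      ≤ eLpNorm f 2 intervalMeasure * eLpNorm g 2 intervalMeasure := by
  refine (enorm_integral_le_lintegral_enorm _).trans ?_
  rw [← eLpNorm_one_eq_lintegral_enorm]
  simpa only [smul_eq_mul] using! eLpNorm_smul_le_mul_eLpNorm (p := 2) (q := 2) (r := 1) hg.1 hf.1

/-- Integration by parts for `u ∈ H¹₀(0, π)` against a function without boundary conditions. -/
theorem IsH10Deriv.integral_mul {u v : L2} (h : IsH10Deriv u v) {g g' : ℝ → ℂ}
    (hg : ∀ x, HasDerivAt g (g' x) x) (hg' : Continuous g') :
    ∫ x, g x * v x ∂intervalMeasure = -∫ x, g' x * u x ∂intervalMeasure := by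
  have hgc : Continuous g := continuous_iff_continuousAt.2 fun x => (hg x).continuousAt
  have hgm := memLp_of_continuous hgc
  have hgm' := memLp_of_continuous hg'
  set C := eLpNorm g 2 intervalMeasure + eLpNorm g' 2 intervalMeasure with hC
  have hCtop : C ≠ ⊤ := ENNReal.add_ne_top.2 ⟨hgm.2.ne, hgm'.2.ne⟩
  -- The identity is exact for a test function `φ` in place of `u`; Cauchy–Schwarz bounds the error
  -- of the replacement by `C * ε`.
  have key : ∀ ε : ENNReal, ε ≠ 0 →
      ‖∫ x, g x * v x ∂intervalMeasure + ∫ x, g' x * u x ∂intervalMeasure‖ₑ ≤ C * ε := by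
    intro ε hε
    obtain ⟨φ, hφ, h1, h2⟩ := h.2 ε hε
    have hφm := memLp_of_continuous hφ.smooth.continuous
    have hφm' := memLp_of_continuous hφ.continuous_deriv
    have hibp := hφ.integral_deriv_mul hg hg'
    simp only [mul_comm (deriv φ _), mul_comm (φ _)] at hibp
    have e1 : ∫ x, g x * (v x - deriv φ x) ∂intervalMeasure
        = ∫ x, g x * v x ∂intervalMeasure - ∫ x, g x * deriv φ x ∂intervalMeasure := by
      have hi : Integrable (fun x => g x * deriv φ x) intervalMeasure := hgm.integrable_mul hφm'
      rw [← integral_sub (integrable_continuous_mul hgc v) hi]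
      simp only [mul_sub]
    have e2 : ∫ x, g' x * (u x - φ x) ∂intervalMeasure
        = ∫ x, g' x * u x ∂intervalMeasure - ∫ x, g' x * φ x ∂intervalMeasure := by
      have hi : Integrable (fun x => g' x * φ x) intervalMeasure := hgm'.integrable_mul hφm
      rw [← integral_sub (integrable_continuous_mul hg' u) hi]
      simp only [mul_sub]
    have e3 : ∫ x, g x * v x ∂intervalMeasure + ∫ x, g' x * u x ∂intervalMeasure
        = ∫ x, g x * (v x - deriv φ x) ∂intervalMeasure
          + ∫ x, g' x * (u x - φ x) ∂intervalMeasure := by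
      rw [e1, e2, hibp]; ring
    rw [e3, hC, add_mul]
    refine (enorm_add_le _ _).trans (add_le_add ?_ ?_)
    · exact (enorm_integral_mul_le hgm ((Lp.memLp v).sub hφm')).trans (by gcongr; exact h2)
    · exact (enorm_integral_mul_le hgm' ((Lp.memLp u).sub hφm)).trans (by gcongr; exact h1)
  have hlim : Tendsto (fun m : ℕ => C * (m : ENNReal)⁻¹) atTop (𝓝 0) := by
    simpa using ENNReal.Tendsto.const_mul ENNReal.tendsto_inv_nat_nhds_zero (Or.inr hCtop)
  have h0 := ge_of_tendsto' hlim fun m => key (m : ENNReal)⁻¹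
    (ENNReal.inv_ne_zero.2 (ENNReal.natCast_ne_top m))
  exact eq_neg_of_add_eq_zero_left (enorm_eq_zero.1 (le_antisymm h0 bot_le))

/-- The derivative vanishes off `[0, 1]`. The weight `y + 1` is what `(m + 1) x (π - x)` becomes in
the cutoff `cutSin`, so this bound is uniform in `m`. -/
theorem exists_bound_deriv_smoothTransition :
    ∃ B : ℝ, 0 ≤ B ∧ ∀ y : ℝ, |deriv Real.smoothTransition y| * |y + 1| ≤ B := by
  have hc : Continuous (fun y : ℝ => deriv Real.smoothTransition y * (y + 1)) :=
    ((Real.smoothTransition.contDiff (n := 1)).continuous_deriv le_rfl).mul (by fun_prop)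
  obtain ⟨B, hB⟩ := isCompact_Icc.exists_bound_of_continuousOn (s := Set.Icc (0 : ℝ) 1)
    hc.continuousOn
  refine ⟨max B 0, le_max_right _ _, fun y => ?_⟩
  rw [← abs_mul]
  by_cases hy : y ∈ Set.Icc (0 : ℝ) 1
  · exact (hB y hy).trans (le_max_left _ _)
  · have h0 : deriv Real.smoothTransition y = 0 := by
      rw [Set.mem_Icc, not_and_or, not_le, not_le] at hy
      rcases hy with hy | hy
      · have : Real.smoothTransition =ᶠ[𝓝 y] fun _ => 0 := by
          filter_upwards [Iio_mem_nhds hy] with z hz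
          exact Real.smoothTransition.zero_of_nonpos hz.le
        rw [this.deriv_eq, deriv_const]
      · have : Real.smoothTransition =ᶠ[𝓝 y] fun _ => 1 := by
          filter_upwards [Ioi_mem_nhds hy] with z hz
          exact Real.smoothTransition.one_of_one_le hz.le
        rw [this.deriv_eq, deriv_const]
    rw [h0, zero_mul, abs_zero]
    exact le_max_right _ _

/-- Vanishing of the sine at both endpoints compensates the growing slope of the cutoff there. The
reflection `x ↦ π - x` reduces to the left half, where `π - x ≥ 1`. -/
theorem abs_sin_nat_mul_le (k : ℕ) {x : ℝ} (hx : x ∈ Set.Ioo (0 : ℝ) Real.pi) :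
    |Real.sin (k * x)| ≤ k * (x * (Real.pi - x)) := by
  have hπ := Real.pi_gt_three
  have hk : (0 : ℝ) ≤ k := k.cast_nonneg
  have hb : ∀ y : ℝ, 0 ≤ y → |Real.sin (k * y)| ≤ k * y := fun y hy =>
    Real.abs_sin_le_abs.trans (abs_of_nonneg (by positivity)).le
  rcases le_total x (Real.pi / 2) with h | h
  · refine (hb x hx.1.le).trans ?_
    gcongr
    nlinarith [hx.1]
  · have he : |Real.sin (k * x)| = |Real.sin (k * (Real.pi - x))| := by
      have h1 : |Real.cos (k * Real.pi)| = 1 := by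
        simpa using Real.abs_cos_int_mul_pi (k : ℤ)
      rw [mul_sub, Real.sin_sub, Real.sin_nat_mul_pi, zero_mul, zero_sub, abs_neg, abs_mul, h1,
        one_mul]
    rw [he]
    refine (hb _ (by linarith [hx.2])).trans ?_
    gcongr
    nlinarith [hx.2]

/-- The function `x ↦ sin (k x)`. -/
def sinFun (k : ℕ) (x : ℝ) : ℂ := (Real.sin (k * x) : ℝ)

/-- The function `x ↦ k cos (k x)`. -/
def dsinFun (k : ℕ) (x : ℝ) : ℂ := (k * Real.cos (k * x) : ℝ)

theorem continuous_sinFun (k : ℕ) : Continuous (sinFun k) := by unfold sinFun; fun_prop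

theorem continuous_dsinFun (k : ℕ) : Continuous (dsinFun k) := by unfold dsinFun; fun_prop

theorem hasDerivAt_sinFun (k : ℕ) (x : ℝ) : HasDerivAt (sinFun k) (dsinFun k x) x := by
  have h : HasDerivAt (fun x : ℝ => Real.sin (k * x)) (k * Real.cos (k * x)) x := by
    simpa [mul_comm] using ((hasDerivAt_id x).const_mul (k : ℝ)).sin
  exact h.ofReal_comp

theorem hasDerivAt_dsinFun (k : ℕ) (x : ℝ) :
    HasDerivAt (dsinFun k) (-(k : ℂ) ^ 2 * sinFun k x) x := by
  have h : HasDerivAt (fun x : ℝ => k * Real.cos (k * x)) (-(k : ℝ) ^ 2 * Real.sin (k * x)) x := by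
    exact (((hasDerivAt_id' x).const_mul (k : ℝ)).cos.const_mul (k : ℝ)).congr_deriv (by ring)
  refine (h.ofReal_comp : HasDerivAt (dsinFun k) _ x).congr_deriv ?_
  simp only [sinFun]
  push_cast
  ring

/-- Cutoff of `sin (k x)` near the endpoints of `(0, π)`. -/
def cutSin (k m : ℕ) (x : ℝ) : ℝ :=
  Real.smoothTransition ((m + 1) * (x * (Real.pi - x)) - 1) * Real.sin (k * x)

theorem contDiff_cutSin (k m : ℕ) : ContDiff ℝ (⊤ : ℕ∞) (cutSin k m) := by
  unfold cutSin
  exact (Real.smoothTransition.contDiff.comp (by fun_prop)).mul (by fun_prop)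

theorem isTest_cutSin (k m : ℕ) : IsTest (fun x => (cutSin k m x : ℂ)) := by
  have hsupp : tsupport (fun x => (cutSin k m x : ℂ))
      ⊆ {x : ℝ | 1 ≤ (m + 1) * (x * (Real.pi - x))} := by
    refine closure_minimal (fun x hx => ?_) (isClosed_le (by fun_prop) (by fun_prop))
    by_contra hlt
    refine hx ?_
    simp only [Set.mem_ofPred_eq, not_le] at hlt
    simp [cutSin, Real.smoothTransition.zero_of_nonpos
      (show (m + 1) * (x * (Real.pi - x)) - 1 ≤ 0 by linarith)]
  have hIoo : {x : ℝ | 1 ≤ (m + 1) * (x * (Real.pi - x))} ⊆ Set.Ioo (0 : ℝ) Real.pi := by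
    intro x hx
    have hm : (0 : ℝ) < m + 1 := by positivity
    have hp : 0 < x * (Real.pi - x) := by
      by_contra hle
      have := mul_nonpos_of_nonneg_of_nonpos hm.le (not_lt.1 hle)
      have hx' : (1 : ℝ) ≤ (m + 1) * (x * (Real.pi - x)) := hx
      linarith
    have := Real.pi_pos
    constructor <;> nlinarith
  refine ⟨Complex.ofRealCLM.contDiff.comp (contDiff_cutSin k m), ?_, hsupp.trans hIoo⟩
  refine HasCompactSupport.of_support_subset_isCompact
    (isCompact_Icc (a := (0 : ℝ)) (b := Real.pi)) ?_
  exact (subset_tsupport _).trans ((hsupp.trans hIoo).trans Set.Ioo_subset_Icc_self)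

theorem deriv_ofReal_cutSin (k m : ℕ) (x : ℝ) :
    deriv (fun x => (cutSin k m x : ℂ)) x = ((deriv Real.smoothTransition
      ((m + 1) * (x * (Real.pi - x)) - 1) * ((m + 1) * (Real.pi - 2 * x)) * Real.sin (k * x)
      + Real.smoothTransition ((m + 1) * (x * (Real.pi - x)) - 1) * (k * Real.cos (k * x)) : ℝ)
      : ℂ) := by
  have h1 : HasDerivAt (fun x : ℝ => ((m : ℝ) + 1) * (x * (Real.pi - x)) - 1)
      ((m + 1) * (Real.pi - 2 * x)) x := by
    exact ((((hasDerivAt_id' x).mul ((hasDerivAt_id' x).const_sub Real.pi)).const_mul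
      ((m : ℝ) + 1)).sub_const 1).congr_deriv (by ring)
  have h2 : HasDerivAt (fun x : ℝ => Real.sin (k * x)) (k * Real.cos (k * x)) x := by
    simpa [mul_comm] using ((hasDerivAt_id x).const_mul (k : ℝ)).sin
  have h3 := ((Real.smoothTransition.contDiff (n := 1)).differentiable (by simp)
    ((m + 1) * (x * (Real.pi - x)) - 1)).hasDerivAt
  exact ((h3.comp x h1).mul h2).ofReal_comp.deriv

theorem eventually_cutSin_eq (k : ℕ) {x : ℝ} (hx : x ∈ Set.Ioo (0 : ℝ) Real.pi) :
    ∀ᶠ m : ℕ in atTop, (fun y => (cutSin k m y : ℂ)) =ᶠ[𝓝 x] sinFun k := by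
  have hp : 0 < x * (Real.pi - x) := mul_pos hx.1 (by linarith [hx.2])
  obtain ⟨M, hM⟩ := exists_nat_gt (2 / (x * (Real.pi - x)))
  filter_upwards [eventually_ge_atTop M] with m hm
  have h1 : (2 : ℝ) < (m + 1) * (x * (Real.pi - x)) := by
    rw [div_lt_iff₀ hp] at hM
    have : (M : ℝ) ≤ m + 1 := by exact_mod_cast hm.trans (Nat.le_succ m)
    exact hM.trans_le (by gcongr)
  have h2 : ∀ᶠ y in 𝓝 x, (2 : ℝ) < (m + 1) * (y * (Real.pi - y)) :=
    (Continuous.tendsto (f := fun y : ℝ => ((m : ℝ) + 1) * (y * (Real.pi - y)))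
      (by fun_prop) x).eventually_const_lt h1
  filter_upwards [h2] with y hy
  simp [cutSin, sinFun, Real.smoothTransition.one_of_one_le
    (show 1 ≤ (m + 1) * (y * (Real.pi - y)) - 1 by linarith)]

theorem norm_cutSin_le (k m : ℕ) (x : ℝ) : ‖(cutSin k m x : ℂ)‖ ≤ 1 := by
  rw [Complex.norm_real, Real.norm_eq_abs, cutSin, abs_mul,
    abs_of_nonneg (Real.smoothTransition.nonneg _)]
  exact mul_le_one₀ (Real.smoothTransition.le_one _) (abs_nonneg _) (Real.abs_sin_le_one _)

/-- The cutoff has slope of order `m + 1`, but the sine is at most `k x (π - x)`, and the product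
`(m + 1) x (π - x)` is absorbed by the bounded weight `y + 1`. Uniformity in `m` allows dominated
convergence of the derivatives. -/
theorem exists_norm_deriv_cutSin_le (k : ℕ) : ∃ C : ℝ, ∀ (m : ℕ),
    ∀ x ∈ Set.Ioo (0 : ℝ) Real.pi, ‖deriv (fun x => (cutSin k m x : ℂ)) x‖ ≤ C := by
  obtain ⟨B, hB0, hB⟩ := exists_bound_deriv_smoothTransition
  refine ⟨Real.pi * k * B + k, fun m x hx => ?_⟩
  rw [deriv_ofReal_cutSin, Complex.norm_real, Real.norm_eq_abs]
  set y := (m + 1) * (x * (Real.pi - x)) - 1 with hy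
  have hm : (0 : ℝ) ≤ m + 1 := by positivity
  have hp : 0 < x * (Real.pi - x) := mul_pos hx.1 (by linarith [hx.2])
  have hy1 : |y + 1| = (m + 1) * (x * (Real.pi - x)) := by
    rw [hy, sub_add_cancel, abs_of_nonneg (by positivity)]
  have hBy := hB y
  rw [hy1] at hBy
  refine (abs_add_le _ _).trans (add_le_add ?_ ?_)
  · rw [abs_mul, abs_mul, abs_mul, abs_of_nonneg hm]
    have h1 : |Real.pi - 2 * x| ≤ Real.pi := abs_le.2 ⟨by linarith [hx.2], by linarith [hx.1]⟩
    calc |deriv Real.smoothTransition y| * ((m + 1) * |Real.pi - 2 * x|) * |Real.sin (k * x)|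
        ≤ |deriv Real.smoothTransition y| * ((m + 1) * Real.pi)
          * (k * (x * (Real.pi - x))) := by
          gcongr
          exact abs_sin_nat_mul_le k hx
      _ = Real.pi * k * (|deriv Real.smoothTransition y| * ((m + 1) * (x * (Real.pi - x)))) := by
          ring
      _ ≤ _ := by gcongr
  · rw [abs_mul, abs_mul, abs_of_nonneg (Real.smoothTransition.nonneg _), Nat.abs_cast]
    calc _ ≤ 1 * (k * 1 : ℝ) := by
          gcongr
          · exact Real.smoothTransition.le_one _
          · exact Real.abs_cos_le_one _
      _ = k := by ring

/-- Bounded pointwise convergence on `(0, π)` implies convergence in `L²`. -/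
theorem tendsto_eLpNorm_sub_of_bounded {f : ℝ → ℂ} {F : ℕ → ℝ → ℂ} {C : ℝ} (hf : Continuous f)
    (hF : ∀ m, Continuous (F m)) (hC : ∀ m, ∀ x ∈ Set.Ioo (0 : ℝ) Real.pi, ‖F m x‖ ≤ C)
    (hlim : ∀ x ∈ Set.Ioo (0 : ℝ) Real.pi, Tendsto (fun m => F m x) atTop (𝓝 (f x))) :
    Tendsto (fun m => eLpNorm (fun x => f x - F m x) 2 intervalMeasure) atTop (𝓝 0) := by
  have h : Tendsto (fun m => ∫⁻ x, ‖f x - F m x‖ₑ ^ (2 : ℝ) ∂intervalMeasure) atTop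
      (𝓝 (∫⁻ _, 0 ∂intervalMeasure)) := by
    refine tendsto_lintegral_of_dominated_convergence
      (fun _ => (ENNReal.ofReal (C + C)) ^ (2 : ℝ)) (fun m => ?_) (fun m => ?_) ?_ ?_
    · exact ((hf.sub (hF m)).enorm.measurable).pow_const _
    · filter_upwards [ae_restrict_mem measurableSet_Ioo] with x hx
      gcongr
      rw [← ofReal_norm]
      refine ENNReal.ofReal_le_ofReal ((norm_sub_le _ _).trans (add_le_add ?_ (hC m x hx)))
      exact le_of_tendsto' (hlim x hx).norm fun m => hC m x hx
    · rw [lintegral_const]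
      exact ENNReal.mul_ne_top (by simp) (measure_ne_top _ _)
    · filter_upwards [ae_restrict_mem measurableSet_Ioo] with x hx
      have h1 : Tendsto (fun m => f x - F m x) atTop (𝓝 0) := by
        simpa using (hlim x hx).const_sub (f x)
      have h2 := h1.enorm
      rw [enorm_zero] at h2
      simpa using h2.ennrpow_const 2
  rw [lintegral_zero] at h
  have h2 := h.ennrpow_const (1 / 2 : ℝ)
  rw [ENNReal.zero_rpow_of_pos (by norm_num)] at h2
  refine h2.congr fun m => ?_
  rw [eLpNorm_eq_lintegral_rpow_enorm_toReal (by simp) (by simp)]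
  simp

/-- The class of `sin (k x)` in `L²(0, π)`. -/
def sinL2 (k : ℕ) : L2 := ofContinuous (sinFun k) (continuous_sinFun k)

theorem tendsto_cutSin (k : ℕ) {x : ℝ} (hx : x ∈ Set.Ioo (0 : ℝ) Real.pi) :
    Tendsto (fun m => (cutSin k m x : ℂ)) atTop (𝓝 (sinFun k x)) :=
  tendsto_const_nhds.congr' ((eventually_cutSin_eq k hx).mono fun _ h => h.eq_of_nhds.symm)

theorem tendsto_deriv_cutSin (k : ℕ) {x : ℝ} (hx : x ∈ Set.Ioo (0 : ℝ) Real.pi) :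
    Tendsto (fun m => deriv (fun x => (cutSin k m x : ℂ)) x) atTop (𝓝 (dsinFun k x)) :=
  tendsto_const_nhds.congr' ((eventually_cutSin_eq k hx).mono fun _ h =>
    ((hasDerivAt_sinFun k x).congr_of_eventuallyEq h).deriv.symm)

theorem isH10Deriv_sinL2 (k : ℕ) :
    IsH10Deriv (sinL2 k) (ofContinuous (dsinFun k) (continuous_dsinFun k)) := by
  refine ⟨IsWeakDeriv.of_hasDerivAt (hasDerivAt_sinFun k) _ _, fun ε hε => ?_⟩
  obtain ⟨C, hC⟩ := exists_norm_deriv_cutSin_le k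
  have h1 := tendsto_eLpNorm_sub_of_bounded (continuous_sinFun k)
    (fun m => (isTest_cutSin k m).smooth.continuous) (fun m x _ => norm_cutSin_le k m x)
    (fun x hx => tendsto_cutSin k hx)
  have h2 := tendsto_eLpNorm_sub_of_bounded (continuous_dsinFun k)
    (fun m => (isTest_cutSin k m).continuous_deriv) hC (fun x hx => tendsto_deriv_cutSin k hx)
  have hε' : 0 < ε := pos_iff_ne_zero.2 hε
  obtain ⟨m, hm1, hm2⟩ := ((h1.eventually_le_const hε').and (h2.eventually_le_const hε')).exists
  refine ⟨_, isTest_cutSin k m, le_of_eq_of_le (eLpNorm_congr_ae ?_) hm1,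
    le_of_eq_of_le (eLpNorm_congr_ae ?_) hm2⟩
  · filter_upwards [coeFn_ofContinuous (continuous_sinFun k)] with x hx
    rw [sinL2, hx]
  · filter_upwards [coeFn_ofContinuous (continuous_dsinFun k)] with x hx
    rw [hx]

theorem sinL2_mem_graph (k : ℕ) :
    (sinL2 k, (-(k : ℂ) ^ 2) • sinL2 k) ∈ dirichletLaplacianGraph := by
  have hc : Continuous fun x => -(k : ℂ) ^ 2 * sinFun k x :=
    continuous_const.mul (continuous_sinFun k)
  refine ⟨_, isH10Deriv_sinL2 k, ?_⟩
  have h := IsWeakDeriv.of_hasDerivAt (hasDerivAt_dsinFun k) (continuous_dsinFun k) hc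
  have he : ofContinuous _ hc = (-(k : ℂ) ^ 2) • sinL2 k := by
    refine Lp.ext ?_
    filter_upwards [coeFn_ofContinuous hc, coeFn_ofContinuous (continuous_sinFun k),
      Lp.coeFn_smul (-(k : ℂ) ^ 2) (sinL2 k)] with x h1 h2 h3
    rw [h1, h3, Pi.smul_apply, sinL2, h2, smul_eq_mul]
  rwa [he] at h

/-- The sine coefficient `∫ sin (k x) u(x) dx`. -/
def sinCoef (k : ℕ) : L2 →ₗ[ℂ] ℂ := pairing (sinFun k) (continuous_sinFun k)

theorem sinCoef_apply (k : ℕ) (u : L2) :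
    sinCoef k u = ∫ x, sinFun k x * u x ∂intervalMeasure := rfl

/-- `∂ₓₓ` acts on sine coefficients as multiplication by `-k²`. -/
theorem sinCoef_of_mem_graph {u w : L2} (h : (u, w) ∈ dirichletLaplacianGraph) (k : ℕ) :
    sinCoef k w = -(k : ℂ) ^ 2 * sinCoef k u := by
  obtain ⟨v, hv, hw⟩ := h
  obtain ⟨C, hC⟩ := exists_norm_deriv_cutSin_le k
  have hlim : ∀ (F : ℕ → ℝ → ℂ) (f : ℝ → ℂ) (D : ℝ) (a : L2), (∀ m, Continuous (F m)) →
      (∀ m, ∀ x ∈ Set.Ioo (0 : ℝ) Real.pi, ‖F m x‖ ≤ D) →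
      (∀ x ∈ Set.Ioo (0 : ℝ) Real.pi, Tendsto (fun m => F m x) atTop (𝓝 (f x))) →
      Tendsto (fun m => ∫ x, F m x * a x ∂intervalMeasure) atTop
        (𝓝 (∫ x, f x * a x ∂intervalMeasure)) := by
    intro F f D a hF hD hFf
    refine tendsto_integral_of_dominated_convergence (fun x => D * ‖a x‖)
      (fun m => (integrable_continuous_mul (hF m) a).1) ?_ (fun m => ?_) ?_
    · exact (((Lp.memLp a).integrable (by norm_num)).norm).const_mul D
    · filter_upwards [ae_restrict_mem measurableSet_Ioo] with x hx
      rw [norm_mul]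
      gcongr
      exact hD m x hx
    · filter_upwards [ae_restrict_mem measurableSet_Ioo] with x hx
      exact (hFf x hx).mul_const _
  have h1 := hlim _ _ 1 w (fun m => (isTest_cutSin k m).smooth.continuous)
    (fun m x _ => norm_cutSin_le k m x) (fun x hx => tendsto_cutSin k hx)
  have h2 := hlim _ _ C v (fun m => (isTest_cutSin k m).continuous_deriv) hC
    (fun x hx => tendsto_deriv_cutSin k hx)
  -- `v` carries no boundary condition, so the sine must supply it: the weak derivative is tested on
  -- `cutSin k m`, and `m → ∞`.
  have h3 : ∫ x, dsinFun k x * v x ∂intervalMeasure = -∫ x, sinFun k x * w x ∂intervalMeasure :=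
    tendsto_nhds_unique h2 (h1.neg.congr fun m => (hw _ (isTest_cutSin k m)).symm)
  -- The cosine does not vanish at the endpoints; here `u ∈ H¹₀` removes the boundary terms.
  have h4 := hv.integral_mul (hasDerivAt_dsinFun k)
    (continuous_const.mul (continuous_sinFun k))
  simp only [mul_assoc] at h4
  rw [integral_const_mul] at h4
  rw [sinCoef_apply, sinCoef_apply]
  linear_combination h3 - h4

/-- Product-to-sum turns `sin ((k+1) x) cos x` into the mean of `sin ((k+2) x)` and `sin (k x)`,
which lowers the power of the cosine by one. -/
theorem integral_sin_mul_cos_pow_mul {u : L2} (h : ∀ k, sinCoef k u = 0) (m k : ℕ) :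
    ∫ x, (sinFun k x * (Real.cos x : ℂ) ^ m) * u x ∂intervalMeasure = 0 := by
  induction m generalizing k with
  | zero => simpa [sinCoef_apply] using h k
  | succ m ih =>
    cases k with
    | zero => simp [sinFun]
    | succ k =>
      have hc : ∀ k, Integrable (fun x => (sinFun k x * (Real.cos x : ℂ) ^ m) * u x)
          intervalMeasure := fun k =>
        integrable_continuous_mul ((continuous_sinFun k).mul (by fun_prop)) u
      have e : ∀ x : ℝ, (sinFun (k + 1) x * (Real.cos x : ℂ) ^ (m + 1)) * u x
          = (1 / 2 : ℂ) * ((sinFun (k + 2) x * (Real.cos x : ℂ) ^ m) * u x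
            + (sinFun k x * (Real.cos x : ℂ) ^ m) * u x) := by
        intro x
        have ht : Real.sin ((k + 1 : ℕ) * x) * Real.cos x
            = 1 / 2 * (Real.sin ((k + 2 : ℕ) * x) + Real.sin (k * x)) := by
          have e1 : ((k + 2 : ℕ) : ℝ) * x = (k + 1 : ℕ) * x + x := by push_cast; ring
          have e2 : (k : ℝ) * x = (k + 1 : ℕ) * x - x := by push_cast; ring
          rw [e1, e2, Real.sin_add, Real.sin_sub]
          ring
        have ht' := congrArg (fun r : ℝ => (r : ℂ)) ht
        simp only [Complex.ofReal_mul, Complex.ofReal_add, Complex.ofReal_div, Complex.ofReal_one,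
          Complex.ofReal_ofNat] at ht'
        simp only [sinFun, pow_succ]
        linear_combination (Real.cos x : ℂ) ^ m * u x * ht'
      simp only [e]
      rw [integral_const_mul, integral_add (hc _) (hc _), ih, ih, add_zero, mul_zero]

theorem integral_sin_mul_polynomial_cos_mul {u : L2} (h : ∀ k, sinCoef k u = 0)
    (p : Polynomial ℝ) :
    ∫ x, ((Real.sin x * p.eval (Real.cos x) : ℝ) : ℂ) * u x ∂intervalMeasure = 0 := by
  have hc : ∀ p : Polynomial ℝ, Integrable
      (fun x => ((Real.sin x * p.eval (Real.cos x) : ℝ) : ℂ) * u x) intervalMeasure := fun p =>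
    integrable_continuous_mul (by fun_prop) u
  induction p using Polynomial.induction_on' with
  | add p q hp hq =>
    simp only [Polynomial.eval_add, mul_add, Complex.ofReal_add, add_mul]
    rw [integral_add (hc p) (hc q), hp, hq, add_zero]
  | monomial m a =>
    have h1 := integral_sin_mul_cos_pow_mul h m 1
    have e : ∀ x : ℝ, ((Real.sin x * (Polynomial.monomial m a).eval (Real.cos x) : ℝ) : ℂ) * u x
        = (a : ℂ) * ((sinFun 1 x * (Real.cos x : ℂ) ^ m) * u x) := by
      intro x
      simp only [Polynomial.eval_monomial, sinFun, Nat.cast_one, one_mul]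
      push_cast
      ring
    simp only [e]
    rw [integral_const_mul, h1, mul_zero]

/-- Weierstrass approximation of `g` on `[-1, 1]` reduces this to polynomials in `cos x`; the error
is controlled by the `L¹` norm of `u`. -/
theorem integral_sin_mul_comp_cos_mul {u : L2} (h : ∀ k, sinCoef k u = 0) {g : ℝ → ℝ}
    (hg : Continuous g) :
    ∫ x, ((Real.sin x * g (Real.cos x) : ℝ) : ℂ) * u x ∂intervalMeasure = 0 := by
  set N := ∫ x, ‖u x‖ ∂intervalMeasure with hN
  have hN0 : 0 ≤ N := integral_nonneg fun _ => norm_nonneg _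
  have hu : Integrable (fun x => u x) intervalMeasure := (Lp.memLp u).integrable (by norm_num)
  rw [← norm_eq_zero]
  refine le_antisymm (le_of_forall_pos_le_add fun ε hε => ?_) (norm_nonneg _)
  obtain ⟨p, hp⟩ := exists_polynomial_near_of_continuousOn (-1) 1 g hg.continuousOn
    (ε / (N + 1)) (by positivity)
  have e : ∫ x, ((Real.sin x * g (Real.cos x) : ℝ) : ℂ) * u x ∂intervalMeasure
      = ∫ x, ((Real.sin x * (g (Real.cos x) - p.eval (Real.cos x)) : ℝ) : ℂ) * u x
        ∂intervalMeasure := by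
    rw [← sub_zero (∫ x, ((Real.sin x * g (Real.cos x) : ℝ) : ℂ) * u x ∂intervalMeasure),
      ← integral_sin_mul_polynomial_cos_mul h p,
      ← integral_sub (integrable_continuous_mul (by fun_prop) u)
        (integrable_continuous_mul (by fun_prop) u)]
    refine integral_congr_ae (Eventually.of_forall fun x => ?_)
    push_cast
    ring
  rw [e, zero_add]
  calc _ ≤ ∫ x, ε / (N + 1) * ‖u x‖ ∂intervalMeasure := by
        refine norm_integral_le_of_norm_le (hu.norm.const_mul _) (Eventually.of_forall fun x => ?_)
        rw [norm_mul, Complex.norm_real, norm_mul, Real.norm_eq_abs, Real.norm_eq_abs]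
        gcongr
        calc |Real.sin x| * |g (Real.cos x) - p.eval (Real.cos x)| ≤ 1 * (ε / (N + 1)) := by
              gcongr
              · exact Real.abs_sin_le_one x
              · rw [abs_sub_comm]
                exact (hp _ ⟨Real.neg_one_le_cos x, Real.cos_le_one x⟩).le
          _ = _ := one_mul _
    _ = ε * (N / (N + 1)) := by rw [integral_const_mul, ← hN]; ring
    _ ≤ ε := mul_le_of_le_one_right hε.le ((div_le_one (by linarith)).2 (by linarith))

/-- The sines are complete in `L²(0, π)`. -/
theorem eq_zero_of_sinCoef_eq_zero {u : L2} (h : ∀ k, sinCoef k u = 0) : u = 0 := by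
  have hu : Integrable (fun x => u x) intervalMeasure := (Lp.memLp u).integrable (by norm_num)
  have hae : ∀ᵐ x ∂(volume : Measure ℝ), x ∈ Set.Ioo (0 : ℝ) Real.pi → u x = 0 := by
    refine isOpen_Ioo.ae_eq_zero_of_integral_contDiff_smul_eq_zero
      (IntegrableOn.locallyIntegrableOn hu) fun φ hφ _ hs => ?_
    have hsin : ∀ x ∈ Set.Ioo (0 : ℝ) Real.pi, Real.sin x ≠ 0 := fun x hx =>
      (Real.sin_pos_of_pos_of_lt_pi hx.1 hx.2).ne'
    have hq : Continuous fun x => φ x / Real.sin x := by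
      refine continuous_of_tsupport fun x hx => ?_
      have hx' : x ∈ tsupport φ := by
        refine closure_mono (fun y hy => ?_) hx
        exact fun h0 => hy (by simp [h0])
      exact hφ.continuous.continuousAt.div Real.continuous_sin.continuousAt (hsin x (hs hx'))
    -- Taking `g = (φ / sin) ∘ arccos` makes `sin x * g (cos x)` equal to `φ x` on `(0, π)`; `φ /
    -- sin` is continuous since `φ` is supported inside the interval.
    have h0 := integral_sin_mul_comp_cos_mul h (hq.comp Real.continuous_arccos)
    have hz : ∀ x, x ∉ Set.Ioo (0 : ℝ) Real.pi → φ x • u x = 0 := fun x hx => by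
      rw [image_eq_zero_of_notMem_tsupport fun h => hx (hs h), zero_smul]
    rw [← setIntegral_eq_integral_of_forall_compl_eq_zero hz, ← h0]
    refine integral_congr_ae ?_
    filter_upwards [ae_restrict_mem measurableSet_Ioo] with x hx
    simp only [Function.comp, Real.arccos_cos hx.1.le hx.2.le]
    rw [mul_div_cancel₀ _ (hsin x hx), Complex.real_smul]
  refine Lp.ext ?_
  have := (ae_restrict_iff' measurableSet_Ioo).2 hae
  filter_upwards [this, Lp.coeFn_zero ℂ 2 intervalMeasure] with x h1 h2
  rw [h1, h2, Pi.zero_apply]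

/-- Orthogonality comes from the Laplacian: its action on `sinL2 l` gives both `-k²` and `-l²` times
the same coefficient. -/
theorem sinCoef_sinL2_of_ne {k l : ℕ} (h : k ≠ l) : sinCoef k (sinL2 l) = 0 := by
  have h1 := sinCoef_of_mem_graph (sinL2_mem_graph l) k
  rw [map_smul, smul_eq_mul] at h1
  have h2 : ((k : ℂ) ^ 2 - (l : ℂ) ^ 2) ≠ 0 := by
    rw [sub_ne_zero]
    intro h3
    have h4 : k ^ 2 = l ^ 2 := by exact_mod_cast h3
    exact h (Nat.pow_left_injective two_ne_zero h4)
  refine (mul_eq_zero.1 (?_ : ((k : ℂ) ^ 2 - (l : ℂ) ^ 2) * sinCoef k (sinL2 l) = 0)).resolve_left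
    h2
  linear_combination h1

theorem sinCoef_sinL2_self {k : ℕ} (hk : 1 ≤ k) : sinCoef k (sinL2 k) ≠ 0 := by
  rw [sinCoef_apply, sinL2, integral_mul_ofContinuous]
  have e : ∀ x, sinFun k x * sinFun k x = ((Real.sin (k * x) ^ 2 : ℝ) : ℂ) := fun x => by
    simp only [sinFun]; push_cast; ring
  simp only [e]
  rw [integral_complex_ofReal, Complex.ofReal_ne_zero]
  have hk' : (k : ℝ) ≠ 0 := by positivity
  rw [← integral_Ioc_eq_integral_Ioo, ← intervalIntegral.integral_of_le Real.pi_pos.le,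
    intervalIntegral.integral_comp_mul_left (fun x => Real.sin x ^ 2) hk', integral_sin_sq,
    Real.sin_nat_mul_pi, mul_zero, Real.sin_zero]
  have := Real.pi_pos
  have hk0 : k ≠ 0 := by omega
  simp [hk0, this.ne']

end DirichletSines

/-! ### Location and separation of the numbers `λ_{j,k}`. -/

section Eigenvalues

open Filter Topology

/-- The `j`-th root `ω` of `|α| ωⁿ = α`. -/
def unitRoot (n : ℕ) (α : ℝ) (j : ℕ) : ℂ :=
  if 0 < α then Complex.exp (2 * Real.pi * j / n * Complex.I)
    else Complex.exp ((2 * j + 1) * Real.pi / n * Complex.I)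

/-- For either sign of `α` the roots form one coset of the `n`-th roots of unity, so both cases can
be treated together from here on. -/
theorem unitRoot_eq_mul_pow (n : ℕ) (α : ℝ) (j : ℕ) :
    unitRoot n α j = unitRoot n α 0 * Complex.exp (2 * Real.pi * Complex.I / n) ^ j := by
  rw [← Complex.exp_nat_mul]
  by_cases h : 0 < α
  · simp only [unitRoot, h, if_true, ← Complex.exp_add]
    congr 1
    push_cast
    ring
  · simp only [unitRoot, h, if_false, ← Complex.exp_add]
    congr 1
    push_cast
    ring

theorem abs_mul_unitRoot_zero_pow {n : ℕ} (hn : n ≠ 0) (α : ℝ) :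
    ((|α| : ℝ) : ℂ) * unitRoot n α 0 ^ n = α := by
  by_cases h : 0 < α
  · simp [unitRoot, h, abs_of_pos h]
  · have hn' : (n : ℂ) ≠ 0 := Nat.cast_ne_zero.2 hn
    have he : (n : ℂ) * ((2 * (0 : ℕ) + 1) * Real.pi / n * Complex.I) = Real.pi * Complex.I := by
      field_simp
      push_cast
      ring
    simp only [unitRoot, h, if_false]
    rw [← Complex.exp_nat_mul, he, Complex.exp_pi_mul_I, abs_of_nonpos (not_lt.1 h)]
    push_cast
    ring

theorem abs_mul_unitRoot_pow {n : ℕ} (hn : n ≠ 0) (α : ℝ) (j : ℕ) :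
    ((|α| : ℝ) : ℂ) * unitRoot n α j ^ n = α := by
  rw [unitRoot_eq_mul_pow, mul_pow, ← mul_assoc, abs_mul_unitRoot_zero_pow hn, ← pow_mul,
    mul_comm j n, pow_mul, (Complex.isPrimitiveRoot_exp n hn).pow_eq_one, one_pow, mul_one]

theorem exists_eq_unitRoot {n : ℕ} (hn : n ≠ 0) {α : ℝ} (hα : α ≠ 0) {ζ : ℂ}
    (h : ((|α| : ℝ) : ℂ) * ζ ^ n = α) : ∃ j : Fin n, ζ = unitRoot n α j := by
  have : NeZero n := ⟨hn⟩
  have hα' : ((|α| : ℝ) : ℂ) ≠ 0 := by simpa using hα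
  have h0 := abs_mul_unitRoot_zero_pow hn α
  have hne : unitRoot n α 0 ≠ 0 := by
    intro hz
    rw [hz, zero_pow hn, mul_zero] at h0
    exact hα (by exact_mod_cast h0.symm)
  have h1 : (ζ / unitRoot n α 0) ^ n = 1 := by
    rw [div_pow, div_eq_one_iff_eq (pow_ne_zero _ hne)]
    exact mul_left_cancel₀ hα' (h.trans h0.symm)
  obtain ⟨i, hi, hζ⟩ := (Complex.isPrimitiveRoot_exp n hn).eq_pow_of_pow_eq_one h1
  refine ⟨⟨i, hi⟩, ?_⟩
  rw [unitRoot_eq_mul_pow, hζ]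
  field_simp

theorem norm_unitRoot (n : ℕ) (α : ℝ) (j : ℕ) : ‖unitRoot n α j‖ = 1 := by
  rw [unitRoot]
  split_ifs
  · have : (2 * Real.pi * j / n * Complex.I : ℂ)
      = ((2 * Real.pi * j / n : ℝ) : ℂ) * Complex.I := by push_cast; ring
    rw [this, Complex.norm_exp_ofReal_mul_I]
  · have : ((2 * j + 1) * Real.pi / n * Complex.I : ℂ)
      = (((2 * j + 1) * Real.pi / n : ℝ) : ℂ) * Complex.I := by push_cast; ring
    rw [this, Complex.norm_exp_ofReal_mul_I]

theorem unitRoot_injective {n : ℕ} (hn : n ≠ 0) (α : ℝ) {i j : Fin n}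
    (h : unitRoot n α i = unitRoot n α j) : i = j := by
  have h0 : unitRoot n α 0 ≠ 0 := by
    rw [← norm_ne_zero_iff, norm_unitRoot]; exact one_ne_zero
  rw [unitRoot_eq_mul_pow n α i, unitRoot_eq_mul_pow n α j] at h
  exact Fin.ext ((Complex.isPrimitiveRoot_exp n hn).pow_inj i.2 j.2 (mul_left_cancel₀ h0 h))

theorem eq_one_or_neg_one_of_im_eq_zero {z : ℂ} (hz : ‖z‖ = 1) (him : z.im = 0) :
    z = 1 ∨ z = -1 := by
  have h : z = (z.re : ℂ) := Complex.ext rfl (by simp [him])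
  rw [h, Complex.norm_real, Real.norm_eq_abs] at hz
  rw [h]
  rcases (abs_eq zero_le_one).1 hz with h1 | h1 <;> simp [h1]

/-- At most one of the roots is real. -/
theorem unitRoot_im_ne_zero {n : ℕ} (hn : n ≠ 0) {α : ℝ} (hα : α ≠ 0) (hodd : 0 < α → Odd n)
    {i j : Fin n} (hij : i ≠ j) (hi : (unitRoot n α i).im = 0) : (unitRoot n α j).im ≠ 0 := by
  intro hj
  -- If both `1` and `-1` were roots, the first would force `α > 0`, hence `n` odd, and the second
  -- would then give `α = -α`.
  have key : ¬ (((|α| : ℝ) : ℂ) * 1 ^ n = α ∧ ((|α| : ℝ) : ℂ) * (-1) ^ n = α) := by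
    rintro ⟨h1, h2⟩
    rw [one_pow, mul_one] at h1
    have h1' : |α| = α := by exact_mod_cast h1
    have hpos : 0 < α := h1' ▸ abs_pos.2 hα
    rw [(hodd hpos).neg_one_pow, h1] at h2
    have h2' : α * -1 = α := by exact_mod_cast h2
    linarith
  have ei := abs_mul_unitRoot_pow hn α i
  have ej := abs_mul_unitRoot_pow hn α j
  rcases eq_one_or_neg_one_of_im_eq_zero (norm_unitRoot n α i) hi with h | h <;>
    rcases eq_one_or_neg_one_of_im_eq_zero (norm_unitRoot n α j) hj with h' | h'
  · exact hij (unitRoot_injective hn α (h.trans h'.symm))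
  · rw [h] at ei; rw [h'] at ej; exact key ⟨ei, ej⟩
  · rw [h] at ei; rw [h'] at ej; exact key ⟨ej, ei⟩
  · exact hij (unitRoot_injective hn α (h.trans h'.symm))

theorem exists_pos_le_of_ne_zero {ι : Type*} [Finite ι] (f : ι → ℝ) (hf : ∀ i, 0 ≤ f i) :
    ∃ η : ℝ, 0 < η ∧ ∀ i, f i ≠ 0 → η ≤ f i := by
  classical
  cases nonempty_fintype ι
  let s := Finset.univ.filter fun i => f i ≠ 0
  rcases s.eq_empty_or_nonempty with hs | hs
  · refine ⟨1, one_pos, fun i hi => absurd (show i ∈ s by simp [s, hi]) (by simp [hs])⟩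
  · obtain ⟨i, hi, hmin⟩ := s.exists_min_image f hs
    exact ⟨f i, lt_of_le_of_ne (hf i) (Ne.symm (by simpa [s] using hi)),
      fun j hj => hmin j (by simp [s, hj])⟩

/-- Source of the extra factor `k^(2/n)`: with `s = 2 - 2/n`, an increment of the leading term
dominates that of the correction by `x^(2-s)`. -/
theorem rpow_mul_rpow_sub_le {x y s : ℝ} (hy : 0 < y) (hyx : y ≤ x) (hs : s ≤ 2) :
    x ^ (2 - s) * (x ^ s - y ^ s) ≤ x ^ 2 - y ^ 2 := by
  have hx : 0 < x := hy.trans_le hyx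
  have h1 : x ^ (2 - s) * x ^ s = x ^ 2 := by
    rw [← Real.rpow_add hx, sub_add_cancel, Real.rpow_two]
  have h2 : y ^ (2 - s) * y ^ s = y ^ 2 := by
    rw [← Real.rpow_add hy, sub_add_cancel, Real.rpow_two]
  have h3 : y ^ (2 - s) * y ^ s ≤ x ^ (2 - s) * y ^ s := by
    gcongr
  rw [mul_sub, h1]
  linarith

theorem sub_le_rpow_sub {x y s : ℝ} (hy : 1 ≤ y) (hyx : y ≤ x) (hs : 1 ≤ s) :
    x - y ≤ x ^ s - y ^ s := by
  have hy0 : 0 < y := by linarith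
  have hx0 : 0 < x := by linarith
  have h1 : x ^ s = x * x ^ (s - 1) := by
    rw [mul_comm, ← Real.rpow_add_one hx0.ne', sub_add_cancel]
  have h2 : y ^ s = y * y ^ (s - 1) := by
    rw [mul_comm, ← Real.rpow_add_one hy0.ne', sub_add_cancel]
  have h3 : y ^ (s - 1) ≤ x ^ (s - 1) := by
    gcongr
  have h4 : 1 ≤ y ^ (s - 1) := Real.one_le_rpow hy (by linarith)
  rw [h1, h2]
  nlinarith

theorem one_le_exponent {n : ℕ} (hn : 2 ≤ n) : (1 : ℝ) ≤ 2 - 2 / (n : ℝ) := by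
  have h : (2 : ℝ) ≤ n := by exact_mod_cast hn
  have : 2 / (n : ℝ) ≤ 1 := (div_le_one (by linarith)).2 h
  linarith

theorem exponent_lt_two {n : ℕ} (hn : 2 ≤ n) : 2 - 2 / (n : ℝ) < 2 := by
  have h : (2 : ℝ) ≤ n := by exact_mod_cast hn
  have : 0 < 2 / (n : ℝ) := by positivity
  linarith

theorem eigval_re (n : ℕ) (d α : ℝ) (j k : ℕ) :
    (eigval n d α j k).re = d * (k : ℝ) ^ 2
      + |α| ^ (1 / (n : ℝ)) * (k : ℝ) ^ (2 - 2 / (n : ℝ)) * (unitRoot n α j).re := by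
  rw [eigval, ← unitRoot, Complex.add_re, Complex.re_ofReal_mul, Complex.ofReal_re]

theorem eigval_im (n : ℕ) (d α : ℝ) (j k : ℕ) :
    (eigval n d α j k).im =
      |α| ^ (1 / (n : ℝ)) * (k : ℝ) ^ (2 - 2 / (n : ℝ)) * (unitRoot n α j).im := by
  rw [eigval, ← unitRoot, Complex.add_im, Complex.im_ofReal_mul, Complex.ofReal_im, zero_add]

theorem tendsto_rpow_two_sub_exponent {n : ℕ} (hn : 2 ≤ n) :
    Tendsto (fun k : ℕ => (k : ℝ) ^ (2 - (2 - 2 / (n : ℝ)))) atTop atTop :=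
  (tendsto_rpow_atTop (by linarith [exponent_lt_two hn])).comp tendsto_natCast_atTop_atTop

/-- For large indices, the eigenvalues are uniformly separated from all others. -/
theorem exists_eigval_gap {n : ℕ} (hn : 2 ≤ n) {d α : ℝ} (hd : 1 ≤ d) (hα : α ≠ 0)
    (hodd : 0 < α → Odd n) : ∃ g : ℝ, 0 < g ∧ ∃ K : ℕ, ∀ (i j : Fin n) (k l : ℕ),
      1 ≤ l → l ≤ k → K ≤ k → (i, k) ≠ (j, l) → g ≤ ‖eigval n d α i k - eigval n d α j l‖ := by
  have hn0 : n ≠ 0 := by omega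
  obtain ⟨η₁, hη₁, h₁⟩ := exists_pos_le_of_ne_zero
    (fun p : Fin n × Fin n => |(unitRoot n α p.1).im - (unitRoot n α p.2).im|)
    (fun _ => abs_nonneg _)
  obtain ⟨η₂, hη₂, h₂⟩ := exists_pos_le_of_ne_zero
    (fun j : Fin n => |(unitRoot n α j).im|) (fun _ => abs_nonneg _)
  obtain ⟨η₃, hη₃, h₃⟩ := exists_pos_le_of_ne_zero
    (fun p : Fin n × Fin n => ‖unitRoot n α p.1 - unitRoot n α p.2‖) (fun _ => norm_nonneg _)
  set c := |α| ^ (1 / (n : ℝ)) with hc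
  have hc0 : 0 < c := Real.rpow_pos_of_pos (abs_pos.2 hα) _
  -- With `M = k^(2/n)`, the bound `M ≥ 1 + c` serves two modes on the same branch, and `M η₁ ≥ 2 +
  -- 4c` serves branches with different imaginary parts.
  obtain ⟨K, hK⟩ := ((tendsto_rpow_two_sub_exponent hn).eventually_ge_atTop
    (max (1 + c) ((2 + 4 * c) / η₁))).exists_forall_of_atTop
  refine ⟨min (min (c * η₁ / 2) (c * η₂)) (min (c * η₃) 1), by positivity, K, ?_⟩
  intro i j k l hl hlk hKk hne
  set s := 2 - 2 / (n : ℝ) with hs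
  have hl1 : (1 : ℝ) ≤ l := by exact_mod_cast hl
  have hlk' : (l : ℝ) ≤ k := by exact_mod_cast hlk
  have hk1 : (1 : ℝ) ≤ k := hl1.trans hlk'
  have hM := hK k hKk
  have hM1 : 1 + c ≤ (k : ℝ) ^ (2 - s) := (le_max_left _ _).trans hM
  have hM2 : 2 + 4 * c ≤ (k : ℝ) ^ (2 - s) * η₁ := by
    rw [← div_le_iff₀ hη₁]; exact (le_max_right _ _).trans hM
  have hX1 : 1 ≤ (k : ℝ) ^ s := Real.one_le_rpow hk1 (by linarith [one_le_exponent hn])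
  have hP := rpow_mul_rpow_sub_le (by linarith) hlk' (exponent_lt_two hn).le
  have hD := sub_le_rpow_sub hl1 hlk' (one_le_exponent hn)
  rw [← hs] at hP hD
  have hre : (eigval n d α i k - eigval n d α j l).re = d * ((k : ℝ) ^ 2 - (l : ℝ) ^ 2)
      + c * ((k : ℝ) ^ s * (unitRoot n α i).re - (l : ℝ) ^ s * (unitRoot n α j).re) := by
    rw [Complex.sub_re, eigval_re, eigval_re]; ring
  have him : (eigval n d α i k - eigval n d α j l).im =
      c * ((k : ℝ) ^ s * (unitRoot n α i).im - (l : ℝ) ^ s * (unitRoot n α j).im) := by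
    rw [Complex.sub_im, eigval_im, eigval_im]; ring
  have hre_le := (Complex.abs_re_le_norm (eigval n d α i k - eigval n d α j l))
  have him_le := (Complex.abs_im_le_norm (eigval n d α i k - eigval n d α j l))
  rw [hre] at hre_le
  rw [him, abs_mul, abs_of_pos hc0] at him_le
  have hωi := abs_le.1 ((Complex.abs_re_le_norm (unitRoot n α i)).trans (norm_unitRoot n α i).le)
  have hωj := abs_le.1 ((Complex.abs_re_le_norm (unitRoot n α j)).trans (norm_unitRoot n α j).le)
  have hωj' := (Complex.abs_im_le_norm (unitRoot n α j)).trans (norm_unitRoot n α j).le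
  rcases hlk.eq_or_lt with rfl | hlt
  · have hij : i ≠ j := fun h => hne (by rw [h])
    have h := h₃ (i, j) (norm_ne_zero_iff.2 (sub_ne_zero.2 fun h => hij
      (unitRoot_injective hn0 α h)))
    have he : eigval n d α i l - eigval n d α j l
        = ((c * (l : ℝ) ^ s : ℝ) : ℂ) * (unitRoot n α i - unitRoot n α j) := by
      rw [eigval, eigval, ← unitRoot, ← unitRoot]; ring
    refine (min_le_right _ _).trans ((min_le_left _ _).trans ?_)
    rw [he, norm_mul, Complex.norm_real, Real.norm_of_nonneg (by positivity)]
    have : c * 1 * η₃ ≤ c * (l : ℝ) ^ s * ‖unitRoot n α i - unitRoot n α j‖ := by gcongr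
    linarith
  have hkl : (1 : ℝ) ≤ k - l := by
    have : (l : ℝ) + 1 ≤ k := by exact_mod_cast hlt
    linarith
  have hY0 : 0 ≤ (l : ℝ) ^ s := by positivity
  generalize (k : ℝ) ^ s = X at *
  generalize (l : ℝ) ^ s = Y at *
  generalize (k : ℝ) ^ (2 - s) = M at *
  have hP0 : 0 ≤ (k : ℝ) ^ 2 - (l : ℝ) ^ 2 := by nlinarith
  have hdP : (k : ℝ) ^ 2 - (l : ℝ) ^ 2 ≤ d * ((k : ℝ) ^ 2 - (l : ℝ) ^ 2) :=
    le_mul_of_one_le_left hP0 hd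
  by_cases hij : i = j
  -- Same branch: the real parts differ by at least `(M - c)(X - Y) ≥ X - Y ≥ 1`.
  · subst hij
    refine (min_le_right _ _).trans ((min_le_right _ _).trans ?_)
    refine le_trans ?_ ((le_abs_self _).trans hre_le)
    have h1 : (1 + c) * (X - Y) ≤ M * (X - Y) := by gcongr; linarith
    have h2 : 0 ≤ c * (X - Y) * (1 + (unitRoot n α i).re) :=
      mul_nonneg (mul_nonneg hc0.le (by linarith)) (by linarith [hωi.1])
    nlinarith
  by_cases hI : (unitRoot n α i).im = (unitRoot n α j).im
  -- Distinct roots with equal imaginary part cannot both be real, so the imaginary parts of the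
  -- eigenvalues differ by at least `c η₂ (X - Y)`.
  · have hj0 : (unitRoot n α j).im ≠ 0 := fun h =>
      unitRoot_im_ne_zero hn0 hα hodd hij (hI.trans h) h
    refine (min_le_left _ _).trans ((min_le_right _ _).trans (le_trans ?_ him_le))
    have h := h₂ j (abs_ne_zero.2 hj0)
    rw [hI, ← sub_mul, abs_mul, abs_of_nonneg (by linarith : 0 ≤ X - Y)]
    gcongr
    calc η₂ ≤ 1 * |(unitRoot n α j).im| := by rw [one_mul]; exact h
      _ ≤ _ := by gcongr; linarith
  · have h := h₁ (i, j) (abs_ne_zero.2 (sub_ne_zero.2 hI))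
    simp only at h
    -- If `X` and `Y` are close, the different imaginary parts of the roots separate the
    -- eigenvalues. Otherwise `k² - l² ≥ M η₁ X / 2 ≥ (1 + 2c) X`, and the corrections cost at most
    -- `2 c X` in the real part.
    rcases le_total (X - Y) (η₁ * X / 2) with hΔ | hΔ
    · refine (min_le_left _ _).trans ((min_le_left _ _).trans (le_trans ?_ him_le))
      rw [mul_div_assoc]
      gcongr
      have h1 : X * (unitRoot n α i).im - Y * (unitRoot n α j).im
          = X * ((unitRoot n α i).im - (unitRoot n α j).im) + (X - Y) * (unitRoot n α j).im := by
        ring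
      have h2 : |X * ((unitRoot n α i).im - (unitRoot n α j).im)|
          - |(X - Y) * (unitRoot n α j).im| ≤ |X * (unitRoot n α i).im
            - Y * (unitRoot n α j).im| := by
        rw [h1]
        have := abs_sub_abs_le_abs_sub (X * ((unitRoot n α i).im - (unitRoot n α j).im))
          (-((X - Y) * (unitRoot n α j).im))
        rwa [abs_neg, sub_neg_eq_add] at this
      rw [abs_mul, abs_mul, abs_of_nonneg (by linarith : 0 ≤ X),
        abs_of_nonneg (by linarith : 0 ≤ X - Y)] at h2
      have h3 : X * η₁ ≤ X * |(unitRoot n α i).im - (unitRoot n α j).im| := by gcongr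
      have h4 : (X - Y) * |(unitRoot n α j).im| ≤ (X - Y) * 1 := by
        gcongr
        linarith
      nlinarith
    · refine (min_le_right _ _).trans ((min_le_right _ _).trans ?_)
      refine le_trans ?_ ((le_abs_self _).trans hre_le)
      have hM0 : 0 ≤ M := by linarith
      have h1 : M * (η₁ * X / 2) ≤ M * (X - Y) := by gcongr
      have h2 : (2 + 4 * c) * X ≤ M * η₁ * X := by gcongr
      have h3 : -(2 * X) ≤ X * (unitRoot n α i).re - Y * (unitRoot n α j).re := by
        have e1 : X * (-1) ≤ X * (unitRoot n α i).re := by gcongr; exact hωi.1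
        have e2 : Y * (unitRoot n α j).re ≤ Y * 1 := by gcongr; exact hωj.2
        linarith
      have h4 := mul_le_mul_of_nonneg_left h3 hc0.le
      linarith

/-- Size of the eigenvalues for large `k`. -/
theorem exists_eigval_bounds {n : ℕ} (hn : 2 ≤ n) {d : ℝ} (α : ℝ) (hd : 1 ≤ d) :
    ∃ K : ℕ, ∀ (j k : ℕ), K ≤ k → 1 ≤ k → (k : ℝ) ^ 2 / 2 ≤ (eigval n d α j k).re ∧
      ‖eigval n d α j k‖ ≤ (d + |α| ^ (1 / (n : ℝ))) * (k : ℝ) ^ 2 := by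
  set c := |α| ^ (1 / (n : ℝ)) with hc
  have hc0 : 0 ≤ c := by positivity
  obtain ⟨K, hK⟩ := ((tendsto_rpow_two_sub_exponent hn).eventually_ge_atTop
    (2 * c)).exists_forall_of_atTop
  refine ⟨K, fun j k hk hk1 => ?_⟩
  have hM := hK k hk
  have hk1' : (1 : ℝ) ≤ k := by exact_mod_cast hk1
  have hMX : (k : ℝ) ^ (2 - (2 - 2 / (n : ℝ))) * (k : ℝ) ^ (2 - 2 / (n : ℝ)) = (k : ℝ) ^ 2 := by
    rw [← Real.rpow_add (by linarith), sub_add_cancel, Real.rpow_two]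
  have hX0 : 0 ≤ (k : ℝ) ^ (2 - 2 / (n : ℝ)) := by positivity
  have hX2 : (k : ℝ) ^ (2 - 2 / (n : ℝ)) ≤ (k : ℝ) ^ 2 := by
    rw [← Real.rpow_two]
    exact Real.rpow_le_rpow_of_exponent_le hk1' (exponent_lt_two hn).le
  constructor
  · rw [eigval_re, ← hc]
    have hω := abs_le.1 ((Complex.abs_re_le_norm (unitRoot n α j)).trans (norm_unitRoot n α j).le)
    have h1 := mul_le_mul_of_nonneg_right hM hX0
    rw [hMX] at h1
    have h2 : 0 ≤ c * (k : ℝ) ^ (2 - 2 / (n : ℝ)) * (1 + (unitRoot n α j).re) :=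
      mul_nonneg (mul_nonneg hc0 hX0) (by linarith [hω.1])
    have h3 : (k : ℝ) ^ 2 ≤ d * (k : ℝ) ^ 2 := le_mul_of_one_le_left (by positivity) hd
    linarith
  · rw [eigval, ← unitRoot]
    refine (norm_add_le _ _).trans ?_
    rw [norm_mul, norm_unitRoot, Complex.norm_real, Complex.norm_real,
      Real.norm_of_nonneg (by positivity), Real.norm_of_nonneg (by positivity), mul_one, ← hc]
    have := mul_le_mul_of_nonneg_left hX2 hc0
    linarith

end Eigenvalues

/-! ### Eigenspaces of `L⋆` and geometric multiplicity. -/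

section Eigenspaces

section Matrices

variable {M : Type*} [AddCommGroup M] [Module ℂ M] {n : ℕ}

theorem sum_matD_transpose_zero (d : ℝ) (a : Fin n → M) {i : Fin n} (hi : (i : ℕ) = 0) :
    ∑ j, (((matD n d).transpose i j : ℝ) : ℂ) • a j = (d : ℂ) • a i := by
  rw [Finset.sum_eq_single i]
  · simp [matD]
  · intro j _ hj
    simp [matD, hj, hi]
  · simp

theorem sum_matD_transpose_succ (d : ℝ) (a : Fin n → M) {i j : Fin n} (hij : (j : ℕ) + 1 = i) :
    ∑ j, (((matD n d).transpose i j : ℝ) : ℂ) • a j = (d : ℂ) • a i + a j := by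
  have hne : j ≠ i := fun h => by subst h; omega
  rw [Finset.sum_eq_add i j hne.symm]
  · simp [matD, hne, hij]
  · intro l _ hl
    have h1 : (l : ℕ) + 1 ≠ i := fun h => hl.2 (Fin.ext (by omega))
    simp [matD, hl.1, h1]
  · simp
  · simp

theorem sum_matA_transpose_zero (α : ℝ) (a : Fin n → M) {i l : Fin n} (hi : (i : ℕ) = 0)
    (hl : (l : ℕ) + 1 = n) :
    ∑ j, (((matA n α).transpose i j : ℝ) : ℂ) • a j = (α : ℂ) • a l := by
  rw [Finset.sum_eq_single l]
  · simp [matA, hi, hl]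
  · intro j _ hj
    have h1 : (j : ℕ) + 1 ≠ n := fun h => hj (Fin.ext (by omega))
    simp [matA, h1]
  · simp

theorem sum_matA_transpose_of_ne_zero (α : ℝ) (a : Fin n → M) {i : Fin n} (hi : (i : ℕ) ≠ 0) :
    ∑ j, (((matA n α).transpose i j : ℝ) : ℂ) • a j = 0 :=
  Finset.sum_eq_zero fun j _ => by simp [matA, hi]

end Matrices

theorem mem_eigenspace_iff {n : ℕ} {d α : ℝ} {z : ℂ} {f : L2Vec n} :
    f ∈ eigenspace n d α z ↔ ∃ w : L2Vec n, (∀ i, (f i, w i) ∈ dirichletLaplacianGraph) ∧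
      ∀ i, z • f i = -(∑ j, (((matD n d).transpose i j : ℝ) : ℂ) • w j)
        + ∑ j, (((matA n α).transpose i j : ℝ) : ℂ) • f j := Iff.rfl

theorem sinCoef_zero (u : L2) : sinCoef 0 u = 0 := by
  simp [sinCoef_apply, sinFun]

/-- The sine coefficients of an eigenfunction solve the eigenvalue problem of the matrix
`k² D⋆ + A⋆`. -/
theorem sinCoef_eigenspace {n : ℕ} {d α : ℝ} {z : ℂ} {f : L2Vec n} (hf : f ∈ eigenspace n d α z)
    (k : ℕ) (i : Fin n) :
    z * sinCoef k (f i)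
      = (k : ℂ) ^ 2 * ∑ j, (((matD n d).transpose i j : ℝ) : ℂ) • sinCoef k (f j)
        + ∑ j, (((matA n α).transpose i j : ℝ) : ℂ) • sinCoef k (f j) := by
  obtain ⟨w, hw, h⟩ := mem_eigenspace_iff.1 hf
  have h1 := congrArg (sinCoef k) (h i)
  rw [map_smul, map_add, map_neg, map_sum, map_sum] at h1
  simp only [map_smul, sinCoef_of_mem_graph (hw _) k, smul_eq_mul] at h1
  simp only [smul_eq_mul]
  rw [h1, Finset.mul_sum, ← Finset.sum_neg_distrib]
  congr 1
  exact Finset.sum_congr rfl fun j _ => by ring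

/-- Row `i + 1` of the matrix equation expresses component `i` as `(z - d k²) / k²` times component
`i + 1`; descending from the last row yields the power. -/
theorem sinCoef_eigenspace_eq {n : ℕ} {d α : ℝ} {z : ℂ} {f : L2Vec n}
    (hf : f ∈ eigenspace n d α z) {k : ℕ} (hk : 1 ≤ k) {l : Fin n} (hl : (l : ℕ) + 1 = n)
    (i : Fin n) :
    sinCoef k (f i) = ((z - d * (k : ℂ) ^ 2) / (k : ℂ) ^ 2) ^ (n - 1 - i) * sinCoef k (f l) := by
  have hk0 : (k : ℂ) ≠ 0 := Nat.cast_ne_zero.2 (by omega)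
  obtain ⟨m, hm⟩ : ∃ m, m = n - 1 - (i : ℕ) := ⟨_, rfl⟩
  rw [← hm]
  induction m generalizing i with
  | zero =>
    have : i = l := Fin.ext (by omega)
    rw [this, pow_zero, one_mul]
  | succ m ih =>
    have hi : (i : ℕ) + 1 < n := by omega
    have h1 := ih ⟨i + 1, hi⟩ (by simp only; omega)
    have h2 := sinCoef_eigenspace hf k ⟨i + 1, hi⟩
    rw [sum_matD_transpose_succ d _ (show (i : ℕ) + 1 = (⟨i + 1, hi⟩ : Fin n) from rfl),
      sum_matA_transpose_of_ne_zero _ _ (by simp), smul_eq_mul, h1] at h2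
    rw [pow_succ]
    field_simp
    field_simp at h2
    linear_combination -h2

/-- The recursion uses every row but the first. The first row, where `α` enters, closes the cycle
and becomes the characteristic equation. -/
theorem sinCoef_eigenspace_last {n : ℕ} {d α : ℝ} {z : ℂ} {f : L2Vec n}
    (hf : f ∈ eigenspace n d α z) {k : ℕ} (hk : 1 ≤ k) {l : Fin n} (hl : (l : ℕ) + 1 = n)
    (h : sinCoef k (f l) ≠ 0) : (z - d * (k : ℂ) ^ 2) ^ n = α * ((k : ℂ) ^ 2) ^ (n - 1) := by
  have hk0 : (k : ℂ) ^ 2 ≠ 0 := pow_ne_zero 2 (Nat.cast_ne_zero.2 (by omega))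
  have h0 := sinCoef_eigenspace hf k ⟨0, by omega⟩
  rw [sum_matD_transpose_zero d _ rfl, sum_matA_transpose_zero α _ rfl hl,
    sinCoef_eigenspace_eq hf hk hl ⟨0, by omega⟩] at h0
  simp only [smul_eq_mul, Nat.sub_zero] at h0
  have h1 : (z - d * (k : ℂ) ^ 2) * ((z - d * (k : ℂ) ^ 2) / (k : ℂ) ^ 2) ^ (n - 1) = α := by
    refine mul_right_cancel₀ h ?_
    linear_combination h0
  have hn : n = n - 1 + 1 := by omega
  rw [div_pow, ← mul_div_assoc, div_eq_iff (pow_ne_zero _ hk0), ← pow_succ', ← hn] at h1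
  exact h1

/-- The scale `s = |α|^(1/n) k^(2-2/n)` satisfies `sⁿ = |α| k^(2(n-1))`, so dividing by it leaves
the equation `|α| ζⁿ = α`. -/
theorem char_eq_iff {n : ℕ} (hn : 2 ≤ n) {d α : ℝ} (hα : α ≠ 0) {z : ℂ} {k : ℕ} (hk : 1 ≤ k) :
    (z - d * (k : ℂ) ^ 2) ^ n = α * ((k : ℂ) ^ 2) ^ (n - 1) ↔
      ∃ j : Fin n, z = eigval n d α j k := by
  have hn0 : n ≠ 0 := by omega
  have hnR : (n : ℝ) ≠ 0 := Nat.cast_ne_zero.2 hn0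
  have hkR : (0 : ℝ) < k := by exact_mod_cast hk
  set s : ℝ := |α| ^ (1 / (n : ℝ)) * (k : ℝ) ^ (2 - 2 / (n : ℝ)) with hs
  have hs0 : 0 < s := mul_pos (Real.rpow_pos_of_pos (abs_pos.2 hα) _)
    (Real.rpow_pos_of_pos hkR _)
  have hsn : s ^ n = |α| * ((k : ℝ) ^ 2) ^ (n - 1) := by
    rw [hs, mul_pow, ← Real.rpow_natCast, ← Real.rpow_mul (abs_nonneg _),
      one_div_mul_cancel hnR, Real.rpow_one, ← Real.rpow_natCast, ← Real.rpow_mul hkR.le]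
    congr 1
    rw [← pow_mul, ← Real.rpow_natCast]
    congr 1
    push_cast [Nat.cast_sub (show 1 ≤ n by omega)]
    field_simp
  have hsnC : (s : ℂ) ^ n = ((|α| : ℝ) : ℂ) * ((k : ℂ) ^ 2) ^ (n - 1) := by exact_mod_cast hsn
  have hsC : (s : ℂ) ≠ 0 := by exact_mod_cast hs0.ne'
  have hkC : ((k : ℂ) ^ 2) ^ (n - 1) ≠ 0 :=
    pow_ne_zero _ (pow_ne_zero 2 (Nat.cast_ne_zero.2 (by omega)))
  have he : ∀ j : ℕ, eigval n d α j k = d * (k : ℂ) ^ 2 + s * unitRoot n α j := fun j => by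
    rw [eigval, ← unitRoot, hs]; push_cast; ring
  constructor
  · intro h
    obtain ⟨j, hj⟩ := exists_eq_unitRoot hn0 hα (ζ := (z - d * (k : ℂ) ^ 2) / s) (by
      rw [div_pow, h, hsnC]
      have : ((|α| : ℝ) : ℂ) ≠ 0 := by simpa using hα
      field_simp)
    refine ⟨j, ?_⟩
    rw [he, ← hj]
    field_simp
    ring
  · rintro ⟨j, rfl⟩
    rw [he, add_sub_cancel_left, mul_pow, hsnC, mul_right_comm, abs_mul_unitRoot_pow hn0]

/-- The eigenfunction of `L⋆` in the `k`-th mode. -/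
def eigenfunction (n : ℕ) (d : ℝ) (z : ℂ) (k : ℕ) : L2Vec n :=
  fun i => ((z - d * (k : ℂ) ^ 2) / (k : ℂ) ^ 2) ^ (n - 1 - i) • sinL2 k

theorem eigenfunction_mem {n : ℕ} (hn : 1 ≤ n) {d α : ℝ} {z : ℂ} {k : ℕ} (hk : 1 ≤ k)
    (h : (z - d * (k : ℂ) ^ 2) ^ n = α * ((k : ℂ) ^ 2) ^ (n - 1)) :
    eigenfunction n d z k ∈ eigenspace n d α z := by
  have hk0 : (k : ℂ) ^ 2 ≠ 0 := pow_ne_zero 2 (Nat.cast_ne_zero.2 (by omega))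
  refine mem_eigenspace_iff.2 ⟨fun i => (-(k : ℂ) ^ 2) • eigenfunction n d z k i, fun i => ?_,
    fun i => ?_⟩
  · have := dirichletLaplacianGraph.smul_mem
      (((z - d * (k : ℂ) ^ 2) / (k : ℂ) ^ 2) ^ (n - 1 - i)) (sinL2_mem_graph k)
    rwa [Prod.smul_mk, smul_comm] at this
  set q := (z - d * (k : ℂ) ^ 2) / (k : ℂ) ^ 2 with hq
  have hz : z = d * (k : ℂ) ^ 2 + q * (k : ℂ) ^ 2 := by
    rw [hq, div_mul_cancel₀ _ hk0]; ring
  rcases Nat.eq_zero_or_pos (i : ℕ) with hi | hi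
  · have hqn : q * (k : ℂ) ^ 2 * q ^ (n - 1) = α := by
      have hn' : n = n - 1 + 1 := by omega
      have h1 : z - d * (k : ℂ) ^ 2 = q * (k : ℂ) ^ 2 := by rw [hz]; ring
      rw [h1] at h
      have hp : (q * (k : ℂ) ^ 2) ^ n = q * (k : ℂ) ^ 2 * q ^ (n - 1) * ((k : ℂ) ^ 2) ^ (n - 1) := by
        conv_lhs => rw [hn']
        rw [pow_succ, mul_pow]
        ring
      rw [hp] at h
      exact mul_right_cancel₀ (pow_ne_zero _ hk0) h
    rw [sum_matD_transpose_zero d _ hi,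
      sum_matA_transpose_zero α _ hi (l := ⟨n - 1, by omega⟩) (by simp only; omega)]
    simp only [eigenfunction, ← hq, hi, smul_smul, ← neg_smul, ← add_smul]
    congr 1
    simp only [Nat.sub_zero, Nat.sub_self, pow_zero]
    rw [hz, ← hqn]
    ring
  · rw [sum_matD_transpose_succ d _ (j := ⟨i - 1, by omega⟩) (i := i) (by simp only; omega),
      sum_matA_transpose_of_ne_zero _ _ hi.ne']
    simp only [eigenfunction, ← hq, smul_smul, ← neg_smul, ← add_smul, add_zero]
    congr 1
    have he : n - 1 - ((i : ℕ) - 1) = n - 1 - i + 1 := by omega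
    rw [he, pow_succ, hz]
    ring

theorem sinCoef_eigenfunction_of_ne {n : ℕ} (d : ℝ) (z : ℂ) {k l : ℕ} (h : k ≠ l) (i : Fin n) :
    sinCoef k (eigenfunction n d z l i) = 0 := by
  rw [eigenfunction, map_smul, sinCoef_sinL2_of_ne h, smul_zero]

theorem sinCoef_eigenfunction_last {n : ℕ} (d : ℝ) (z : ℂ) {k : ℕ} (hk : 1 ≤ k) {l : Fin n}
    (hl : (l : ℕ) + 1 = n) : sinCoef k (eigenfunction n d z k l) ≠ 0 := by
  have : n - 1 - (l : ℕ) = 0 := by omega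
  rw [eigenfunction, this, pow_zero, one_smul]
  exact sinCoef_sinL2_self hk

/-- An eigenvalue that occurs in a single mode is geometrically simple. -/
theorem geomMult_eq_one {n : ℕ} (hn : 2 ≤ n) {d α : ℝ} (hα : α ≠ 0) {z : ℂ} {k : ℕ} (hk : 1 ≤ k)
    (hz : ∃ j : Fin n, z = eigval n d α j k)
    (huniq : ∀ (j : Fin n) (m : ℕ), 1 ≤ m → z = eigval n d α j m → m = k) :
    geomMult n d α z = 1 := by
  have hl : ((⟨n - 1, by omega⟩ : Fin n) : ℕ) + 1 = n := by simp only; omega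
  set l : Fin n := ⟨n - 1, by omega⟩
  have hv := eigenfunction_mem (by omega : 1 ≤ n) hk ((char_eq_iff hn hα hk).2 hz)
  have hvl := sinCoef_eigenfunction_last d z hk hl
  refine finrank_eq_one_iff'.2 ⟨⟨_, hv⟩, fun h => hvl ?_, fun w => ?_⟩
  · have h1 : eigenfunction n d z k = 0 := congrArg Subtype.val h
    rw [h1, Pi.zero_apply, map_zero]
  obtain ⟨f, hf⟩ := w
  set c := sinCoef k (f l) / sinCoef k (eigenfunction n d z k l) with hc
  refine ⟨c, Subtype.ext ?_⟩
  change c • eigenfunction n d z k = f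
  -- The scalar `c` cancels the last coefficient in mode `k`; in every other mode it vanishes
  -- because `z` is not a root there. The recursion and completeness then kill the difference.
  have hg : c • eigenfunction n d z k - f ∈ eigenspace n d α z :=
    Submodule.sub_mem _ (Submodule.smul_mem _ _ hv) hf
  have hlast : ∀ m, 1 ≤ m → sinCoef m ((c • eigenfunction n d z k - f) l) = 0 := by
    intro m hm
    by_contra hne
    obtain ⟨j, hj⟩ := (char_eq_iff hn hα hm).1 (sinCoef_eigenspace_last hg hm hl hne)
    obtain rfl := huniq j m hm hj
    refine hne ?_
    rw [Pi.sub_apply, Pi.smul_apply, map_sub, map_smul, smul_eq_mul, hc, div_mul_cancel₀ _ hvl,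
      sub_self]
  refine sub_eq_zero.1 (funext fun i => eq_zero_of_sinCoef_eq_zero fun m => ?_)
  rcases Nat.eq_zero_or_pos m with rfl | hm
  · exact sinCoef_zero _
  · rw [sinCoef_eigenspace_eq hg hm hl, hlast m hm, mul_zero]

/-- An eigenvalue that occurs in two modes is not geometrically simple. -/
theorem geomMult_ne_one {n : ℕ} (hn : 2 ≤ n) {d α : ℝ} (hα : α ≠ 0) {i j : Fin n} {k m : ℕ}
    (hk : 1 ≤ k) (hm : 1 ≤ m) (hkm : k ≠ m) (h : eigval n d α i k = eigval n d α j m) :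
    geomMult n d α (eigval n d α i k) ≠ 1 := by
  intro h1
  have hl : ((⟨n - 1, by omega⟩ : Fin n) : ℕ) + 1 = n := by simp only; omega
  set l : Fin n := ⟨n - 1, by omega⟩
  set z := eigval n d α i k with hz
  have hvk := eigenfunction_mem (by omega : 1 ≤ n) hk ((char_eq_iff hn hα hk).2 ⟨i, hz⟩)
  have hvm := eigenfunction_mem (by omega : 1 ≤ n) hm ((char_eq_iff hn hα hm).2 ⟨j, h⟩)
  obtain ⟨v, -, hv⟩ := finrank_eq_one_iff'.1 h1
  obtain ⟨a, ha⟩ := hv ⟨_, hvk⟩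
  obtain ⟨b, hb⟩ := hv ⟨_, hvm⟩
  have ha' : ∀ p, a * sinCoef p (v.1 l) = sinCoef p (eigenfunction n d z k l) := fun p => by
    have : eigenfunction n d z k = a • v.1 := (congrArg Subtype.val ha).symm
    rw [this, Pi.smul_apply, map_smul, smul_eq_mul]
  have hb' : ∀ p, b * sinCoef p (v.1 l) = sinCoef p (eigenfunction n d z m l) := fun p => by
    have : eigenfunction n d z m = b • v.1 := (congrArg Subtype.val hb).symm
    rw [this, Pi.smul_apply, map_smul, smul_eq_mul]
  have h2 := ha' k
  have h3 := hb' k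
  have h4 := hb' m
  rw [sinCoef_eigenfunction_of_ne d z hkm] at h3
  have hkk := sinCoef_eigenfunction_last d z hk hl
  have hmm := sinCoef_eigenfunction_last d z hm hl
  -- The mode-`m` eigenfunction has no coefficient in mode `k`. Either it is the zero multiple of
  -- `v`, or `v` has no last coefficient in mode `k`; each contradicts a nonzero last coefficient.
  rcases mul_eq_zero.1 h3 with h5 | h5
  · rw [h5, zero_mul] at h4
    exact hmm h4.symm
  · rw [h5, mul_zero] at h2
    exact hkk h2.symm

end Eigenspaces

/-! ### Derivative of the interpolating product and the condensation index. -/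

section CondensationIndex

open Filter Topology

/-- The derivative of the interpolating function at one of its nodes. -/
theorem deriv_interpolating {ι : Type*} [DecidableEq ι] {Λ : ι → ℂ}
    (hs : Summable fun k => (‖Λ k‖ ^ 2)⁻¹) (h0 : ∀ k, Λ k ≠ 0) (k : ι) :
    deriv (interpolating Λ) (Λ k)
      = -2 / Λ k * ∏' m, (1 + if m = k then 0 else -(Λ k ^ 2 / Λ m ^ 2)) := by
  set a : ι → ℂ → ℂ := fun m z => if m = k then 0 else -(z ^ 2 / Λ m ^ 2) with ha
  set F : ℂ → ℂ := fun z => ∏' m, (1 + a m z) with hF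
  have hsq : ∀ z : ℂ, Summable fun m => ‖-(z ^ 2 / Λ m ^ 2)‖ := fun z => by
    simpa [div_eq_mul_inv] using hs.mul_left (‖z‖ ^ 2)
  have hfac : ∀ z, interpolating Λ z = (1 - z ^ 2 / Λ k ^ 2) * F z := by
    intro z
    have hm : Multipliable (Function.update (fun m => 1 - z ^ 2 / Λ m ^ 2) k 1) := by
      have h : Summable fun m => ‖a m z‖ := by
        refine (hsq z).of_nonneg_of_le (fun _ => norm_nonneg _) fun m => ?_
        by_cases hmk : m = k <;> simp [ha, hmk]
        positivity
      refine (multipliable_one_add_of_summable h).congr fun m => ?_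
      by_cases hmk : m = k
      · subst hmk; simp [ha]
      · simp [ha, hmk, sub_eq_add_neg]
    rw [interpolating, hm.tprod_eq_mul_tprod_ite' k]
    congr 1
    refine tprod_congr fun m => ?_
    by_cases hmk : m = k <;> simp [ha, hmk, sub_eq_add_neg]
  -- Continuity of the remaining product suffices: the removed factor vanishes at `Λ k`, so its
  -- difference quotient gives the derivative directly.
  have hcont : ContinuousAt F (Λ k) := by
    have hopen : IsOpen (Metric.ball (0 : ℂ) (‖Λ k‖ + 1)) := Metric.isOpen_ball
    have hP := Summable.hasProdLocallyUniformlyOn_one_add (f := a) hopen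
      (hs.mul_left ((‖Λ k‖ + 1) ^ 2)) (Eventually.of_forall fun m z hz => ?_) (fun m => ?_)
    · refine ContinuousOn.continuousAt ?_ (hopen.mem_nhds (by simp : Λ k ∈ _))
      refine (hasProdLocallyUniformlyOn_iff_tendstoLocallyUniformlyOn.1 hP).continuousOn
        (Frequently.of_forall fun s => ?_)
      refine continuousOn_finsetProd _ fun m _ => ?_
      by_cases hmk : m = k
      · simp only [ha, hmk, if_true]; fun_prop
      · simp only [ha, hmk, if_false]; fun_prop
    · rw [mem_ball_zero_iff] at hz
      by_cases hmk : m = k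
      · simp only [ha, hmk, if_true, norm_zero]; positivity
      · simp only [ha, hmk, if_false]
        rw [norm_neg, norm_div, norm_pow, norm_pow, div_eq_mul_inv]
        gcongr
    · by_cases hmk : m = k
      · simp only [ha, hmk, if_true]; fun_prop
      · simp only [ha, hmk, if_false]; fun_prop
  have hz : 1 - Λ k ^ 2 / Λ k ^ 2 = 0 := by rw [div_self (pow_ne_zero 2 (h0 k)), sub_self]
  refine HasDerivAt.deriv ?_
  rw [hasDerivAt_iff_tendsto_slope]
  have hl : Tendsto (fun z => -(z + Λ k) / Λ k ^ 2 * F z) (𝓝[≠] (Λ k))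
      (𝓝 (-(Λ k + Λ k) / Λ k ^ 2 * F (Λ k))) := by
    refine Tendsto.mono_left ?_ nhdsWithin_le_nhds
    refine Tendsto.mul (Continuous.tendsto (by fun_prop) _) hcont
  have he : -(Λ k + Λ k) / Λ k ^ 2 * F (Λ k) = -2 / Λ k * F (Λ k) := by
    have := h0 k
    field_simp
    ring
  rw [he] at hl
  refine hl.congr' ?_
  filter_upwards [self_mem_nhdsWithin] with z hzk
  have hzk' : z - Λ k ≠ 0 := sub_ne_zero.2 hzk
  have := h0 k
  rw [slope_def_field, hfac z, hfac (Λ k), hz]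
  field_simp
  ring

/-- Any exponent strictly between `1/2` and `1` would serve the argument, with another constant:
above `1/2` the sum over eigenvalues converges, and below `1` there is room for a logarithm. -/
theorem log_one_add_sq_le {t : ℝ} (ht : 0 < t) :
    Real.log (1 + t ^ 2) ≤ 4 * t ^ (3 / 4 : ℝ) := by
  have hq : 0 ≤ t ^ (3 / 4 : ℝ) := by positivity
  rcases le_total t 1 with h | h
  · have h1 : Real.log (1 + t ^ 2) ≤ t ^ 2 := by
      have := Real.log_le_sub_one_of_pos (show 0 < 1 + t ^ 2 by positivity)
      linarith
    have h2 : t ^ (2 : ℝ) ≤ t ^ (3 / 4 : ℝ) :=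
      Real.rpow_le_rpow_of_exponent_ge ht h (by norm_num)
    rw [Real.rpow_two] at h2
    linarith
  · have h1 : Real.log (1 + t ^ 2) ≤ Real.log (2 * t ^ 2) :=
      Real.log_le_log (by positivity) (by nlinarith)
    rw [Real.log_mul (by norm_num) (by positivity), Real.log_pow] at h1
    have h2 := Real.log_le_rpow_div ht.le (show (0 : ℝ) < 3 / 4 by norm_num)
    have h3 : 1 ≤ t ^ (3 / 4 : ℝ) := Real.one_le_rpow h (by norm_num)
    have h4 := Real.log_two_lt_d9
    push_cast at h1
    linarith

theorem le_rpow_three_quarters {t : ℝ} (h : 1 / 2 ≤ t) : 1 / 2 ≤ t ^ (3 / 4 : ℝ) := by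
  rcases le_total t 1 with h1 | h1
  · have := Real.rpow_le_rpow_of_exponent_ge (by linarith) h1 (show (3 / 4 : ℝ) ≤ 1 by norm_num)
    rw [Real.rpow_one] at this
    linarith
  · have := Real.one_le_rpow h1 (show (0 : ℝ) ≤ 3 / 4 by norm_num)
    linarith

/-- Two-sided bound for the logarithm of a factor of the interpolating product. -/
theorem abs_log_norm_factor_le {z w : ℂ} {δ g : ℝ} (hδ : 0 < δ) (hg : 0 < g)
    (hz : δ * ‖z‖ ≤ z.re) (hw : 0 < w.re) (hz1 : 1 ≤ ‖z‖) (hgap : g ≤ ‖w - z‖) :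
    |Real.log ‖1 - z ^ 2 / w ^ 2‖| ≤
      (6 + 2 * |Real.log (4 / (g * δ))|) * (1 + Real.log ‖z‖) * (‖z‖ / ‖w‖) ^ (3 / 4 : ℝ) := by
  have hw0 : w ≠ 0 := fun h => by simp [h] at hw
  have hwn : 0 < ‖w‖ := norm_pos_iff.2 hw0
  set t := ‖z‖ / ‖w‖ with ht
  have ht0 : 0 < t := by positivity
  set q := t ^ (3 / 4 : ℝ) with hq
  have hq0 : 0 < q := by positivity
  set c := |Real.log (4 / (g * δ))| with hc
  have hc0 : 0 ≤ c := abs_nonneg _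
  have hl0 : 0 ≤ Real.log ‖z‖ := Real.log_nonneg hz1
  have hn : ‖z ^ 2 / w ^ 2‖ = t ^ 2 := by rw [norm_div, norm_pow, norm_pow, ht, div_pow]
  have hfac : ‖1 - z ^ 2 / w ^ 2‖ = ‖w - z‖ * ‖w + z‖ / ‖w‖ ^ 2 := by
    rw [← norm_mul, ← norm_pow, ← norm_div]
    congr 1
    field_simp
    ring
  have hsum : δ * ‖z‖ ≤ ‖w + z‖ := by
    have := Complex.re_le_norm (w + z)
    rw [Complex.add_re] at this
    linarith
  have hpos : 0 < ‖1 - z ^ 2 / w ^ 2‖ := by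
    rw [hfac]
    have h1 : 0 < ‖w - z‖ := hg.trans_le hgap
    have h2 : 0 < ‖w + z‖ := lt_of_lt_of_le (by positivity) hsum
    positivity
  have hup : Real.log ‖1 - z ^ 2 / w ^ 2‖ ≤ 4 * q := by
    refine (Real.log_le_log hpos ?_).trans (log_one_add_sq_le ht0)
    have := norm_sub_le 1 (z ^ 2 / w ^ 2)
    rwa [hn, norm_one] at this
  have hC : 4 * q ≤ (6 + 2 * c) * (1 + Real.log ‖z‖) * q := by
    refine mul_le_mul_of_nonneg_right ?_ hq0.le
    nlinarith [mul_nonneg hc0 hl0]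
  refine abs_le.2 ⟨?_, hup.trans hC⟩
  rw [neg_le]
  -- For `t ≤ 1/2` the factor is close to `1` and needs no gap. Otherwise `|w| ≤ 2|z|`, and `|w - z|
  -- ≥ g` with `|w + z| ≥ δ|z|` bounds it below by `gδ / (4|z|)`; the lost logarithm is affordable
  -- because `q ≥ 1/2`.
  rcases le_total t (1 / 2) with h | h
  · refine le_trans ?_ hC
    have h1 : 1 - t ^ 2 ≤ ‖1 - z ^ 2 / w ^ 2‖ := by
      have := norm_sub_norm_le 1 (z ^ 2 / w ^ 2)
      rwa [hn, norm_one] at this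
    have h3 : t ^ 2 ≤ 1 / 4 := by nlinarith
    have h2 := Real.log_le_log (by linarith) h1
    have h4 := Real.one_sub_inv_le_log_of_pos (show 0 < 1 - t ^ 2 by linarith)
    have h5 : (1 - t ^ 2)⁻¹ ≤ 1 + 4 * t ^ 2 := by
      rw [inv_le_iff_one_le_mul₀ (by linarith)]
      nlinarith [sq_nonneg t]
    have h6 : t ^ (2 : ℝ) ≤ q :=
      Real.rpow_le_rpow_of_exponent_ge ht0 (by linarith) (by norm_num)
    rw [Real.rpow_two] at h6
    linarith
  · have h1 : g * δ / (4 * ‖z‖) ≤ ‖1 - z ^ 2 / w ^ 2‖ := by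
      have hwz : ‖w‖ ≤ 2 * ‖z‖ := by
        rw [ht, le_div_iff₀ hwn] at h
        linarith
      have hw2 : ‖w‖ ^ 2 ≤ (2 * ‖z‖) ^ 2 := by gcongr
      rw [hfac, div_le_div_iff₀ (by positivity) (by positivity)]
      have h2 : g * (δ * ‖z‖) ≤ ‖w - z‖ * ‖w + z‖ := by gcongr
      calc g * δ * ‖w‖ ^ 2 ≤ g * δ * (2 * ‖z‖) ^ 2 := by gcongr
        _ = g * (δ * ‖z‖) * (4 * ‖z‖) := by ring
        _ ≤ _ := by gcongr
    have h2 := Real.log_le_log (by positivity) h1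
    have h3 : Real.log (g * δ / (4 * ‖z‖)) = -(Real.log (4 / (g * δ)) + Real.log ‖z‖) := by
      rw [← Real.log_mul (by positivity) (by positivity), ← Real.log_inv]
      congr 1
      field_simp
    have h4 : Real.log (4 / (g * δ)) ≤ c := le_abs_self _
    have h5 : 1 / 2 ≤ q := le_rpow_three_quarters h
    have h6 : (c + Real.log ‖z‖) ≤ (6 + 2 * c) * (1 + Real.log ‖z‖) * (1 / 2) := by
      nlinarith [mul_nonneg hc0 hl0]
    have h7 : (6 + 2 * c) * (1 + Real.log ‖z‖) * (1 / 2)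
        ≤ (6 + 2 * c) * (1 + Real.log ‖z‖) * q := by gcongr
    linarith

theorem norm_tendsto_atTop_of_summable {ι : Type*} {Λ : ι → ℂ} (h0 : ∀ k, Λ k ≠ 0)
    (hs : Summable fun k => 1 / ‖Λ k‖) : Tendsto (fun k => ‖Λ k‖) cofinite atTop := by
  have h := hs.tendsto_cofinite_zero
  have h' : Tendsto (fun k => 1 / ‖Λ k‖) cofinite (𝓝[>] 0) :=
    tendsto_nhdsWithin_iff.2 ⟨h, Eventually.of_forall fun k => by
      have := norm_pos_iff.2 (h0 k)
      simp [this]⟩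
  refine h'.inv_tendsto_nhdsGT_zero.congr fun k => ?_
  simp

/-- A sectorial sequence with convergence exponent below `1` and uniformly separated far terms has
condensation index zero. -/
theorem condensationIndex_eq_zero {ι : Type*} [Infinite ι] {Λ : ι → ℂ}
    (hΛ : SectorialSummable Λ) (hs : Summable fun k => ‖Λ k‖ ^ (-(3 / 4) : ℝ)) {g : ℝ}
    (hg : 0 < g) (hgap : ∀ᶠ k in cofinite, ∀ m, m ≠ k → g ≤ ‖Λ m - Λ k‖) :
    condensationIndex Λ = 0 := by
  classical
  obtain ⟨-, hs1, δ, hδ, hsec⟩ := hΛ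
  have hn0 : ∀ k, 0 < ‖Λ k‖ := fun k => pos_of_mul_pos_right (hsec k).2 hδ.le
  have h0 : ∀ k, Λ k ≠ 0 := fun k => norm_pos_iff.1 (hn0 k)
  have hre : ∀ k, 0 < (Λ k).re := fun k => (hsec k).2.trans_le (hsec k).1
  have htop := norm_tendsto_atTop_of_summable h0 hs1
  have hs2 : Summable fun k => (‖Λ k‖ ^ 2)⁻¹ := by
    refine hs1.of_norm_bounded_eventually ?_
    filter_upwards [htop.eventually_ge_atTop 1] with k hk
    rw [Real.norm_of_nonneg (by positivity), one_div]
    exact inv_anti₀ (hn0 k) (by nlinarith)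
  set C := 6 + 2 * |Real.log (4 / (g * δ))| with hC
  have hC0 : 0 ≤ C := by positivity
  set S := ∑' k, ‖Λ k‖ ^ (-(3 / 4) : ℝ) with hS
  have hS0 : 0 ≤ S := tsum_nonneg fun k => by positivity
  have key : ∀ᶠ k in cofinite,
      ‖-Real.log ‖deriv (interpolating Λ) (Λ k)‖ / (Λ k).re‖
        ≤ (9 * (1 + C * S) / δ) * ‖Λ k‖ ^ (-(1 / 8) : ℝ) := by
    filter_upwards [htop.eventually_ge_atTop 1, hgap] with k hk1 hk
    set R := ‖Λ k‖ with hR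
    have hR0 : 0 < R := hn0 k
    have hl0 : 0 ≤ Real.log R := Real.log_nonneg hk1
    set a : ι → ℂ := fun m => if m = k then 0 else -(Λ k ^ 2 / Λ m ^ 2) with ha
    have hterm : ∀ m, |Real.log ‖1 + a m‖| ≤
        C * (1 + Real.log R) * R ^ (3 / 4 : ℝ) * ‖Λ m‖ ^ (-(3 / 4) : ℝ) := by
      intro m
      by_cases hmk : m = k
      · simp only [ha, hmk, if_true, add_zero, norm_one, Real.log_one, abs_zero]
        positivity
      · have := abs_log_norm_factor_le hδ hg (hsec k).1 (hre m) hk1 (hk m hmk)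
        simp only [ha, hmk, if_false, ← sub_eq_add_neg]
        rw [Real.div_rpow (norm_nonneg _) (norm_nonneg _),
          div_eq_mul_inv (‖Λ k‖ ^ (3 / 4 : ℝ)), ← Real.rpow_neg (norm_nonneg _)] at this
        rw [mul_assoc _ (R ^ (3 / 4 : ℝ))]
        exact this
    have hne : ∀ m, 1 + a m ≠ 0 := by
      intro m
      by_cases hmk : m = k
      · simp [ha, hmk]
      · simp only [ha, hmk, if_false, ← sub_eq_add_neg]
        intro h
        have h1 : (Λ m - Λ k) * (Λ m + Λ k) = 0 := by
          have := h0 m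
          field_simp at h
          linear_combination h
        rcases mul_eq_zero.1 h1 with h2 | h2
        · have := hk m hmk
          rw [h2, norm_zero] at this
          linarith
        · have h3 := congrArg Complex.re h2
          simp only [Complex.add_re, Complex.zero_re] at h3
          linarith [hre m, hre k]
    have hsa : Summable fun m => ‖a m‖ := by
      refine (hs2.mul_left (R ^ 2)).of_nonneg_of_le (fun _ => norm_nonneg _) fun m => ?_
      by_cases hmk : m = k
      · simp only [ha, hmk, if_true, norm_zero]; positivity
      · simp only [ha, hmk, if_false]
        rw [norm_neg, norm_div, norm_pow, norm_pow, div_eq_mul_inv]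
    have hlogP : Real.log ‖∏' m, (1 + a m)‖ = ∑' m, Real.log ‖1 + a m‖ := by
      rw [(multipliable_one_add_of_summable hsa).norm_tprod,
        ← Real.rexp_tsum_eq_tprod (fun m => norm_pos_iff.2 (hne m))
          hsa.summable_log_norm_one_add, Real.log_exp]
    have hbound : |∑' m, Real.log ‖1 + a m‖| ≤ C * (1 + Real.log R) * R ^ (3 / 4 : ℝ) * S := by
      rw [← Real.norm_eq_abs, hS, ← tsum_mul_left]
      exact tsum_of_norm_bounded (hs.mul_left _).hasSum hterm
    have hP0 : ‖∏' m, (1 + a m)‖ ≠ 0 :=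
      norm_ne_zero_iff.2 (tprod_one_add_ne_zero_of_summable hne hsa)
    have hlog : Real.log ‖deriv (interpolating Λ) (Λ k)‖
        = Real.log 2 - Real.log R + ∑' m, Real.log ‖1 + a m‖ := by
      rw [deriv_interpolating hs2 h0 k, norm_mul, Real.log_mul (by simp [h0 k]) hP0, hlogP,
        norm_div, norm_neg, Complex.norm_ofNat, Real.log_div (by norm_num) hR0.ne']
    -- Spending `R^(1/8)` on the logarithm raises the exponent `3/4` to `7/8`, still below `1`.
    have h18 : 1 + Real.log R ≤ 9 * R ^ (1 / 8 : ℝ) := by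
      have h1 := Real.log_le_rpow_div hR0.le (show (0 : ℝ) < 1 / 8 by norm_num)
      have h2 : 1 ≤ R ^ (1 / 8 : ℝ) := Real.one_le_rpow hk1 (by norm_num)
      linarith
    have habs : |Real.log ‖deriv (interpolating Λ) (Λ k)‖| ≤ 9 * (1 + C * S) * R ^ (7 / 8 : ℝ) := by
      have h34 : 1 ≤ R ^ (3 / 4 : ℝ) := Real.one_le_rpow hk1 (by norm_num)
      have hl2 := Real.log_two_lt_d9
      have hl2' := Real.log_two_gt_d9
      have h1 : |Real.log ‖deriv (interpolating Λ) (Λ k)‖|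
          ≤ (1 + Real.log R) + C * (1 + Real.log R) * R ^ (3 / 4 : ℝ) * S := by
        rw [hlog]
        refine (abs_add_le _ _).trans (add_le_add ?_ hbound)
        rw [abs_le]
        constructor <;> linarith
      have h78 : R ^ (7 / 8 : ℝ) = R ^ (1 / 8 : ℝ) * R ^ (3 / 4 : ℝ) := by
        rw [← Real.rpow_add hR0]; norm_num
      calc _ ≤ (1 + Real.log R) + C * (1 + Real.log R) * R ^ (3 / 4 : ℝ) * S := h1
        _ ≤ (1 + Real.log R) * R ^ (3 / 4 : ℝ)
            + C * (1 + Real.log R) * R ^ (3 / 4 : ℝ) * S := by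
          gcongr
          exact le_mul_of_one_le_right (by linarith) h34
        _ = (1 + C * S) * R ^ (3 / 4 : ℝ) * (1 + Real.log R) := by ring
        _ ≤ (1 + C * S) * R ^ (3 / 4 : ℝ) * (9 * R ^ (1 / 8 : ℝ)) := by gcongr
        _ = _ := by rw [h78]; ring
    rw [norm_div, norm_neg, Real.norm_eq_abs, Real.norm_of_nonneg (hre k).le,
      div_le_iff₀ (hre k)]
    refine habs.trans ?_
    have h8 : R ^ (7 / 8 : ℝ) = R ^ (-(1 / 8) : ℝ) * R := by
      rw [← Real.rpow_add_one hR0.ne']; norm_num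
    calc 9 * (1 + C * S) * R ^ (7 / 8 : ℝ)
        = 9 * (1 + C * S) / δ * R ^ (-(1 / 8) : ℝ) * (δ * R) := by rw [h8]; field_simp
      _ ≤ _ := by gcongr; exact (hsec k).1
  have hlim : Tendsto (fun k => -Real.log ‖deriv (interpolating Λ) (Λ k)‖ / (Λ k).re)
      cofinite (𝓝 0) := by
    refine squeeze_zero_norm' key ?_
    have := ((tendsto_rpow_neg_atTop (show (0 : ℝ) < 1 / 8 by norm_num)).comp htop).const_mul
      (9 * (1 + C * S) / δ)
    simpa using this
  have hE : Tendsto (fun k => ((-Real.log ‖deriv (interpolating Λ) (Λ k)‖ / (Λ k).re : ℝ) : EReal))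
      cofinite (𝓝 ((0 : ℝ) : EReal)) := (continuous_coe_real_ereal.tendsto 0).comp hlim
  exact hE.limsup_eq

end CondensationIndex

/-! ### The hypotheses of the condensation theorem for the simple eigenvalues. -/

section Assembly

open Filter Topology

/-- All but finitely many eigenvalues are geometrically simple with positive real part. -/
theorem exists_forall_mem_indexSet {n : ℕ} (hn : 2 ≤ n) {d α : ℝ} (hd : 1 ≤ d) (hα : α ≠ 0)
    (hodd : 0 < α → Odd n) :
    ∃ K : ℕ, ∀ (j : Fin n) (k : ℕ), K ≤ k → 1 ≤ k → (j, k) ∈ indexSet n d α := by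
  obtain ⟨g, hg, K₁, h₁⟩ := exists_eigval_gap hn hd hα hodd
  obtain ⟨K₂, h₂⟩ := exists_eigval_bounds hn α hd
  refine ⟨max K₁ K₂, fun j k hk hk1 => ⟨hk1, ?_, ?_⟩⟩
  · refine geomMult_eq_one hn hα hk1 ⟨j, rfl⟩ fun i m hm h => ?_
    by_contra hne
    have hK : K₁ ≤ k := (le_max_left _ _).trans hk
    have hlt : 0 < ‖eigval n d α j k - eigval n d α i m‖ := by
      rcases le_total m k with hmk | hmk
      · exact hg.trans_le (h₁ j i k m hm hmk hK fun h => hne (Prod.ext_iff.1 h).2.symm)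
      · rw [norm_sub_rev]
        exact hg.trans_le (h₁ i j m k hk1 hmk (hK.trans hmk) fun h => hne (Prod.ext_iff.1 h).2)
    rw [sub_eq_zero.2 h, norm_zero] at hlt
    exact hlt.false
  · have hk0 : (0 : ℝ) < k := by exact_mod_cast hk1
    exact lt_of_lt_of_le (by positivity) (h₂ j k ((le_max_right _ _).trans hk) hk1).1

theorem infinite_indexSet {n : ℕ} (hn : 2 ≤ n) {d α : ℝ} (hd : 1 ≤ d) (hα : α ≠ 0)
    (hodd : 0 < α → Odd n) : (indexSet n d α).Infinite := by
  obtain ⟨K, hK⟩ := exists_forall_mem_indexSet hn hd hα hodd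
  refine Set.infinite_of_injective_forall_mem
    (f := fun k : ℕ => ((⟨0, by omega⟩ : Fin n), k + K + 1)) (fun a b h => ?_)
    (fun k => hK _ _ (by omega) (by omega))
  have := (Prod.ext_iff.1 h).2
  simp only at this
  omega

theorem eventually_indexSet_ge (n : ℕ) (d α : ℝ) (K : ℕ) :
    ∀ᶠ p : indexSet n d α in cofinite, K ≤ p.1.2 := by
  rw [eventually_cofinite]
  refine Set.Finite.preimage (f := Subtype.val) Subtype.val_injective.injOn
    (s := {p : Fin n × ℕ | ¬ K ≤ p.2}) ?_
  refine (Set.finite_univ.prod (Set.finite_Iio K)).subset fun p hp => ?_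
  exact ⟨Set.mem_univ _, not_le.1 hp⟩

/-- Coincidence across modes would contradict simplicity, and within one mode the roots are
distinct. -/
theorem simpleEigval_injective {n : ℕ} (hn : 2 ≤ n) {d α : ℝ} (hα : α ≠ 0) :
    Function.Injective (simpleEigval n d α) := by
  rintro ⟨⟨i, k⟩, hk, hμ, _⟩ ⟨⟨j, l⟩, hl, _, _⟩ h
  change eigval n d α i k = eigval n d α j l at h
  simp only at hk hl hμ
  obtain rfl : k = l := by
    by_contra hne
    exact geomMult_ne_one hn hα hk hl hne h hμ
  obtain rfl : i = j := by
    refine unitRoot_injective (by omega) α ?_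
    rw [eigval, eigval, ← unitRoot, ← unitRoot] at h
    have hk0 : (0 : ℝ) < k := by exact_mod_cast hk
    have hs : ((|α| ^ (1 / (n : ℝ)) * (k : ℝ) ^ (2 - 2 / (n : ℝ)) : ℝ) : ℂ) ≠ 0 := by
      have := abs_pos.2 hα
      rw [Complex.ofReal_ne_zero]
      positivity
    exact mul_left_cancel₀ hs (add_left_cancel h)
  rfl

theorem summable_norm_simpleEigval_rpow {n : ℕ} (hn : 2 ≤ n) {d : ℝ} (α : ℝ) (hd : 1 ≤ d) {p : ℝ}
    (hp : 1 / 2 < p) : Summable fun q => ‖simpleEigval n d α q‖ ^ (-p) := by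
  obtain ⟨K, hK⟩ := exists_eigval_bounds hn α hd
  have hs : Summable fun q : Fin n × ℕ => 2 ^ p * (q.2 : ℝ) ^ (-(2 * p)) := by
    refine (summable_prod_of_nonneg fun q => by positivity).2 ⟨fun j => ?_, .of_finite⟩
    exact (Real.summable_nat_rpow.2 (by linarith)).mul_left _
  refine (hs.comp_injective (i := fun q : indexSet n d α => q.1)
    Subtype.val_injective).of_norm_bounded_eventually ?_
  filter_upwards [eventually_indexSet_ge n d α K] with q hq
  have hk : (0 : ℝ) < q.1.2 := by exact_mod_cast q.2.1
  rw [Real.norm_of_nonneg (by positivity)]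
  have h1 : (q.1.2 : ℝ) ^ 2 / 2 ≤ ‖simpleEigval n d α q‖ :=
    (hK q.1.1 q.1.2 hq q.2.1).1.trans (Complex.re_le_norm _)
  calc ‖simpleEigval n d α q‖ ^ (-p) ≤ ((q.1.2 : ℝ) ^ 2 / 2) ^ (-p) :=
        Real.rpow_le_rpow_of_nonpos (by positivity) h1 (by linarith)
    _ = 2 ^ p * (q.1.2 : ℝ) ^ (-(2 * p)) := by
        rw [Real.div_rpow (by positivity) (by norm_num), ← Real.rpow_two, ← Real.rpow_mul hk.le,
          Real.rpow_neg (by norm_num) p, div_inv_eq_mul, mul_comm, mul_neg]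

theorem sectorialSummable_simpleEigval {n : ℕ} (hn : 2 ≤ n) {d α : ℝ} (hd : 1 ≤ d) (hα : α ≠ 0) :
    SectorialSummable (simpleEigval n d α) := by
  have hre : ∀ q, 0 < (simpleEigval n d α q).re := fun q => q.2.2.2
  have hnorm : ∀ q, 0 < ‖simpleEigval n d α q‖ := fun q =>
    (hre q).trans_le (Complex.re_le_norm _)
  refine ⟨fun i k hik h => hik (simpleEigval_injective hn hα h), ?_, ?_⟩
  · refine (summable_norm_simpleEigval_rpow hn α hd (p := 1) (by norm_num)).congr fun q => ?_
    rw [Real.rpow_neg_one, one_div]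
  obtain ⟨K, hK⟩ := exists_eigval_bounds hn α hd
  set D := d + |α| ^ (1 / (n : ℝ)) with hD
  have hD0 : 0 < D := by positivity
  have hfin : {q : indexSet n d α | ¬ K ≤ q.1.2}.Finite :=
    eventually_cofinite.1 (eventually_indexSet_ge n d α K)
  -- The asymptotic bounds give the sector ratio `1 / (2D)` for `k ≥ K`; the finitely many remaining
  -- terms have positive real part, so their ratios have a positive minimum.
  have : Finite {q : indexSet n d α | ¬ K ≤ q.1.2} := hfin
  obtain ⟨η, hη, hmin⟩ := exists_pos_le_of_ne_zero
    (fun q : {q : indexSet n d α | ¬ K ≤ q.1.2} =>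
      (simpleEigval n d α q).re / ‖simpleEigval n d α q‖)
    (fun q => (div_pos (hre _) (hnorm _)).le)
  have hδ : 0 < min η (1 / (2 * D)) := lt_min hη (by positivity)
  refine ⟨_, hδ, fun q => ⟨?_, mul_pos hδ (hnorm q)⟩⟩
  by_cases hq : K ≤ q.1.2
  · obtain ⟨h1, h2⟩ := hK q.1.1 q.1.2 hq q.2.1
    calc min η (1 / (2 * D)) * ‖simpleEigval n d α q‖
        ≤ 1 / (2 * D) * (D * (q.1.2 : ℝ) ^ 2) := by
          gcongr
          · exact min_le_right _ _
          · exact h2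
      _ = (q.1.2 : ℝ) ^ 2 / 2 := by field_simp
      _ ≤ _ := h1
  · have h1 := hmin ⟨q, hq⟩ (div_pos (hre _) (hnorm _)).ne'
    rw [le_div_iff₀ (hnorm _)] at h1
    refine le_trans ?_ h1
    gcongr
    exact min_le_left _ _

theorem eventually_gap_simpleEigval {n : ℕ} (hn : 2 ≤ n) {d α : ℝ} (hd : 1 ≤ d) (hα : α ≠ 0)
    (hodd : 0 < α → Odd n) : ∃ g : ℝ, 0 < g ∧ ∀ᶠ q in cofinite, ∀ p, p ≠ q →
      g ≤ ‖simpleEigval n d α p - simpleEigval n d α q‖ := by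
  obtain ⟨g, hg, K, hK⟩ := exists_eigval_gap hn hd hα hodd
  refine ⟨g, hg, ?_⟩
  filter_upwards [eventually_indexSet_ge n d α K] with q hq p hpq
  -- The gap requires only the larger mode to be at least `K`, so it holds against every `p`,
  -- including those of small mode.
  rcases le_total p.1.2 q.1.2 with h | h
  · rw [norm_sub_rev]
    exact hK _ _ _ _ p.2.1 h hq fun he => hpq (Subtype.ext he.symm)
  · exact hK _ _ _ _ q.2.1 h (hq.trans h) fun he => hpq (Subtype.ext he)

end Assembly

end ParabolicJordan

end

theorem mainTheorem9 (n : ℕ) (hn : 2 ≤ n) (d α : ℝ) (hd : 1 ≤ d) (hα : α ≠ 0)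
    (hodd : 0 < α → Odd n) :
    (ParabolicJordan.indexSet n d α).Infinite ∧
    ParabolicJordan.SectorialSummable (ParabolicJordan.simpleEigval n d α) ∧
    ParabolicJordan.condensationIndex (ParabolicJordan.simpleEigval n d α) = 0 := by
  have hinf := ParabolicJordan.infinite_indexSet hn hd hα hodd
  have hsec := ParabolicJordan.sectorialSummable_simpleEigval hn hd hα
  have : Infinite (ParabolicJordan.indexSet n d α) := hinf.to_subtype
  obtain ⟨g, hg, hgap⟩ := ParabolicJordan.eventually_gap_simpleEigval hn hd hα hodd
  exact ⟨hinf, hsec, ParabolicJordan.condensationIndex_eq_zero hsec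
    (ParabolicJordan.summable_norm_simpleEigval_rpow hn α hd (by norm_num)) hg hgap⟩
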